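/- Let $k\ge 1$, let $\mathbb B_k$ be the closed unit ball of $\mathbb R^k$, $f(x)=(1,x_1,\dots,x_k)^\top$, and let $\beta=(\beta_0,\beta_1,0,\dots,0)\in\mathbb R^{k+1}$ with $\beta_1>0$. For $\lambda:\mathbb R\to(0,\infty)$ the information matrix of a design $\xi$ (a probability measure on $\mathbb B_k$) is $M(\xi)=\int \lambda(f(x)^\top\beta)\,f(x)f(x)^\top\,\xi(dx)$; $\xi$ is locally $D$-optimal if $M(\xi)$ is regular and $\det M(\xi)\ge\det M(\xi')$ for all designs $\xi'$. A probability measure $\xi_1$ on $[-1,1]$ is a locally $D$-optimal marginal design if $\xi_1\otimes\bar\eta$ is locally $D$-optimal, where $\bar\eta(x_1,\cdot)$ is the uniform distribution of $(x_2,\dots,x_k)$ on the sphere of radius $\sqrt{1-x_1^2}$ in $\mathbb R^{k-1}$ (for $k=1$, $\xi_1\otimes\bar\eta=\xi_1$). Put $u=1/\lambda$ and $q(t)=\lambda(\beta_0+\beta_1t)$. Assume: (A1) $\lambda$ is positive and twice continuously differentiable; (A2$'$) for some $c_\lambda\in\mathbb R$, $\lambda'>0$ on $(-\infty,c_\lambda)$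 and $\lambda'<0$ on $(c_\lambda,\infty)$; (A3$'$) with the same $c_\lambda$, $u''$ is injective on $(-\infty,c_\lambda]$ and injective on $[c_\lambda,\infty)$; (A5) $|u(x)/x^2|\to\infty$ as $x\to\infty$. Then there is exactly one locally $D$-optimal marginal design $\xi_1^*$. It has exactly two support points $x_{11}^*>x_{12}^*$ in $[-1,1]$; let $w_1=\xi_1^*(\{x_{11}^*\})$ and $w_2=\xi_1^*(\{x_{12}^*\})$. Moreover: (a) Suppose $\frac{c_\lambda-\beta_0}{\beta_1}>1$ and, if $k\ge2$, suppose that the function $u''$ (which by (A3$'$) is strictly monotone on $(-\infty,c_\lambda]$) is decreasing there; this is automatic if $|u(x)/x^2|\to\infty$ also as $x\to-\infty$. Then $x_{11}^*=1$, $w_1=\frac1{k+1}$, $w_2=\frac k{k+1}$. For $k\ge2$, $x_{12}^*\in(-1,1)$ solves $\frac{q'(x)}{q(x)}=\frac{2(1+kx)}{k(1-x^2)}$. For $k=1$: if $x\in[-1,1)$ solves $\frac{q'(x)}{q(x)}=\frac2{1-x}$, then $x_{12}^*=x$; if there is no such $x$, then $x_{12}^*=-1$. (b) Suppose $\frac{c_\lambda-\beta_0}{\beta_1}<-1$.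 Then $x_{12}^*=-1$, $w_1=\frac k{k+1}$, $w_2=\frac1{k+1}$. For $k\ge2$, $x_{11}^*\in(-1,1)$ solves $\frac{q'(x)}{q(x)}=\frac{2(-1+kx)}{k(1-x^2)}$. For $k=1$: if $x\in(-1,1]$ solves $\frac{q'(x)}{q(x)}=\frac{-2}{1+x}$, then $x_{11}^*=x$; if there is no such $x$, then $x_{11}^*=1$. If in addition (A4) $\lambda'/\lambda$ is non-increasing, then for $\frac{c_\lambda-\beta_0}{\beta_1}>1$ the equation in (a), and for $\frac{c_\lambda-\beta_0}{\beta_1}<-1$ the equation in (b), has at most one solution in the stated interval. (c) Suppose $\frac{c_\lambda-\beta_0}{\beta_1}\in[-1,1]$. If $x,y\in(-1,1)$ with $x>y$ and $\alpha\in(0,1)$ solve, with $B=q(x)(1-x^2)\alpha+q(y)(1-y^2)(1-\alpha)$, $$\frac{q'(x)}{q(x)}+\frac2{x-y}+(k-1)\frac{q'(x)(1-x^2)\alpha-2x\,q(x)\alpha}{B}=0,$$ $$\frac{q'(y)}{q(y)}-\frac2{x-y}+(k-1)\frac{q'(y)(1-y^2)(1-\alpha)-2y\,q(y)(1-\alpha)}{B}=0,$$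 $$\frac1\alpha-\frac1{1-\alpha}+(k-1)\frac{q(x)(1-x^2)-q(y)(1-y^2)}{B}=0,$$ then $x_{11}^*=x$, $x_{12}^*=y$, $w_1=\alpha$, $w_2=1-\alpha$. If there is no such solution, then $x_{11}^*,x_{12}^*,w_1,w_2$ are as in the conclusion of (a) or as in the conclusion of (b). -/

import Mathlib

open MeasureTheory Set Filter

noncomputable section

/-! ### The model and local D-optimality on the unit ball -/

/-- The regression function `f(x) = (1, x₁, …, x_k)`. -/
def regressor {k : ℕ} (x : EuclideanSpace ℝ (Fin k)) : Fin (k + 1) → ℝ :=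
  Fin.cons 1 (fun i => x i)

/-- The linear predictor `f(x)ᵀ β = β₀ + β₁ x₁ + … + β_k x_k`. -/
def linPredictor {k : ℕ} (β : Fin (k + 1) → ℝ) (x : EuclideanSpace ℝ (Fin k)) : ℝ :=
  ∑ i, regressor x i * β i

/-- The elemental information matrix `M(x, β) = λ(f(x)ᵀ β) f(x) f(x)ᵀ`. -/
def elementalInfo {k : ℕ} (lam : ℝ → ℝ) (β : Fin (k + 1) → ℝ) (x : EuclideanSpace ℝ (Fin k)) :
    Matrix (Fin (k + 1)) (Fin (k + 1)) ℝ :=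
  lam (linPredictor β x) • Matrix.vecMulVec (regressor x) (regressor x)

/-- A (generalized) design: a probability measure on the `k`-dimensional unit ball, regarded as a
probability measure on `ℝᵏ` that is concentrated on the closed unit ball. -/
def IsDesign {k : ℕ} (ξ : Measure (EuclideanSpace ℝ (Fin k))) : Prop :=
  IsProbabilityMeasure ξ ∧ ξ (Metric.closedBall 0 1)ᶜ = 0

/-- The information matrix `M(ξ, β) = ∫ M(x, β) ξ(dx)`, entry by entry. -/
def infoMatrix {k : ℕ} (lam : ℝ → ℝ) (β : Fin (k + 1) → ℝ)
    (ξ : Measure (EuclideanSpace ℝ (Fin k))) : Matrix (Fin (k + 1)) (Fin (k + 1)) ℝ :=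
  Matrix.of fun i j => ∫ x, elementalInfo lam β x i j ∂ξ

/-- `ξ` is locally D-optimal at `β`: its information matrix is regular and has maximal determinant
among all designs on the unit ball. -/
def IsLocallyDOptimal {k : ℕ} (lam : ℝ → ℝ) (β : Fin (k + 1) → ℝ)
    (ξ : Measure (EuclideanSpace ℝ (Fin k))) : Prop :=
  IsDesign ξ ∧ IsUnit (infoMatrix lam β ξ) ∧
    ∀ ξ' : Measure (EuclideanSpace ℝ (Fin k)), IsDesign ξ' →
      (infoMatrix lam β ξ').det ≤ (infoMatrix lam β ξ).det

/-! ### Marginal designs and the invariant designs `ξ₁ ⊗ η̄` -/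

/-- The uniform distribution on the unit sphere of `ℝᵈ`: the normalized surface measure for `d ≥ 1`,
and the point mass at the only point of `ℝ⁰` for `d = 0`. -/
def uniformSphere (d : ℕ) : Measure (EuclideanSpace ℝ (Fin d)) :=
  if d = 0 then Measure.dirac 0
  else (((volume : Measure (EuclideanSpace ℝ (Fin d))).toSphere univ)⁻¹ •
    (volume : Measure (EuclideanSpace ℝ (Fin d))).toSphere).map Subtype.val

/-- The point of `ℝᵏ` with first coordinate `t` and remaining coordinates `√(1 - t²) y`. -/
def orbitPoint {k : ℕ} (t : ℝ) (y : EuclideanSpace ℝ (Fin (k - 1))) : EuclideanSpace ℝ (Fin k) :=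
  WithLp.toLp 2 fun i =>
    if h : (i : ℕ) = 0 then t else √(1 - t ^ 2) * y ⟨(i : ℕ) - 1, by have := i.isLt; omega⟩

/-- The design `ξ₁ ⊗ η̄`, where, given `x₁`, the kernel `η̄(x₁, ·)` is the uniform distribution of
`(x₂, …, x_k)` on the sphere of radius `√(1 - x₁²)` in `ℝ^(k-1)`. For `k = 1` there are no further
coordinates and `ξ₁ ⊗ η̄` is `ξ₁` itself. -/
def invariantDesign (k : ℕ) (ξ₁ : Measure ℝ) : Measure (EuclideanSpace ℝ (Fin k)) :=
  (ξ₁.prod (uniformSphere (k - 1))).map fun p => orbitPoint p.1 p.2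

/-- `ξ₁` is a locally D-optimal marginal design: a probability measure on `[-1, 1]` for which
`ξ₁ ⊗ η̄` is locally D-optimal among all designs on the unit ball. -/
def IsLocallyDOptimalMarginal {k : ℕ} (lam : ℝ → ℝ) (β : Fin (k + 1) → ℝ) (ξ₁ : Measure ℝ) : Prop :=
  IsProbabilityMeasure ξ₁ ∧ ξ₁ (Icc (-1) 1)ᶜ = 0 ∧
    IsLocallyDOptimal lam β (invariantDesign k ξ₁)

/-! ### Conditions on the intensity function -/

/-- (A1) `λ` is positive and twice continuously differentiable. -/
def CondA1 (lam : ℝ → ℝ) : Prop := (∀ x, 0 < lam x) ∧ ContDiff ℝ 2 lam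

/-- (A2') `λ` is unimodal with mode `c`. -/
def CondA2' (lam : ℝ → ℝ) (c : ℝ) : Prop :=
  (∀ x < c, 0 < deriv lam x) ∧ ∀ x > c, deriv lam x < 0

/-- The second derivative `u''` of `u = 1 / λ`. -/
def recipDeriv2 (lam : ℝ → ℝ) : ℝ → ℝ := deriv (deriv fun x => 1 / lam x)

/-- (A3') `u''` is injective on `(-∞, c]` and injective on `[c, ∞)`. -/
def CondA3' (lam : ℝ → ℝ) (c : ℝ) : Prop :=
  InjOn (recipDeriv2 lam) (Iic c) ∧ InjOn (recipDeriv2 lam) (Ici c)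

/-- (A4) `λ' / λ` is non-increasing. -/
def CondA4 (lam : ℝ → ℝ) : Prop := Antitone fun x => deriv lam x / lam x

/-- (A5) `u = 1 / λ` dominates `x²` as `x → ∞`. -/
def CondA5 (lam : ℝ → ℝ) : Prop :=
  Tendsto (fun x => |(1 / lam x) / x ^ 2|) atTop atTop

/-! ### The possible forms of the optimal marginal design

Here `q` is the function `q(x₁) = λ(β₀ + β₁ x₁)`. -/

/-- `x` solves `q'(x) / q(x) = 2 (1 + k x) / (k (1 - x²))`. -/
def EqUpper (k : ℕ) (q : ℝ → ℝ) (x : ℝ) : Prop :=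
  deriv q x / q x = 2 * (1 + k * x) / (k * (1 - x ^ 2))

/-- `x` solves `q'(x) / q(x) = 2 / (1 - x)`. -/
def EqUpperOne (q : ℝ → ℝ) (x : ℝ) : Prop := deriv q x / q x = 2 / (1 - x)

/-- `x` solves `q'(x) / q(x) = 2 (-1 + k x) / (k (1 - x²))`. -/
def EqLower (k : ℕ) (q : ℝ → ℝ) (x : ℝ) : Prop :=
  deriv q x / q x = 2 * (-1 + k * x) / (k * (1 - x ^ 2))

/-- `x` solves `q'(x) / q(x) = -2 / (1 + x)`. -/
def EqLowerOne (q : ℝ → ℝ) (x : ℝ) : Prop := deriv q x / q x = -2 / (1 + x)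

/-- The form of the design in case (a): `x₁₁ = 1`, the weights are `1/(k+1)` and `k/(k+1)`, and
`x₁₂` is determined by the corresponding equation. -/
def UpperForm (k : ℕ) (q : ℝ → ℝ) (ξ₁ : Measure ℝ) (x₁₁ x₁₂ : ℝ) : Prop :=
  x₁₁ = 1 ∧ ξ₁.real {x₁₁} = 1 / (k + 1) ∧ ξ₁.real {x₁₂} = k / (k + 1) ∧
  (2 ≤ k → x₁₂ ∈ Ioo (-1) 1 ∧ EqUpper k q x₁₂) ∧
  (k = 1 → (∀ x ∈ Ico (-1 : ℝ) 1, EqUpperOne q x → x₁₂ = x) ∧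
    ((¬ ∃ x ∈ Ico (-1 : ℝ) 1, EqUpperOne q x) → x₁₂ = -1))

/-- In case (a) the equation for `x₁₂` has at most one solution. -/
def UpperUnique (k : ℕ) (q : ℝ → ℝ) : Prop :=
  (2 ≤ k → {x ∈ Ioo (-1 : ℝ) 1 | EqUpper k q x}.Subsingleton) ∧
  (k = 1 → {x ∈ Ico (-1 : ℝ) 1 | EqUpperOne q x}.Subsingleton)

/-- The form of the design in case (b): `x₁₂ = -1`, the weights are `k/(k+1)` and `1/(k+1)`, and
`x₁₁` is determined by the corresponding equation. -/
def LowerForm (k : ℕ) (q : ℝ → ℝ) (ξ₁ : Measure ℝ) (x₁₁ x₁₂ : ℝ) : Prop :=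
  x₁₂ = -1 ∧ ξ₁.real {x₁₁} = k / (k + 1) ∧ ξ₁.real {x₁₂} = 1 / (k + 1) ∧
  (2 ≤ k → x₁₁ ∈ Ioo (-1) 1 ∧ EqLower k q x₁₁) ∧
  (k = 1 → (∀ x ∈ Ioc (-1 : ℝ) 1, EqLowerOne q x → x₁₁ = x) ∧
    ((¬ ∃ x ∈ Ioc (-1 : ℝ) 1, EqLowerOne q x) → x₁₁ = 1))

/-- In case (b) the equation for `x₁₁` has at most one solution. -/
def LowerUnique (k : ℕ) (q : ℝ → ℝ) : Prop :=
  (2 ≤ k → {x ∈ Ioo (-1 : ℝ) 1 | EqLower k q x}.Subsingleton) ∧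
  (k = 1 → {x ∈ Ioc (-1 : ℝ) 1 | EqLowerOne q x}.Subsingleton)

/-- `x > y` in `(-1, 1)` and `α ∈ (0, 1)` solve the stationarity system of case (c). -/
def InteriorSolution (k : ℕ) (q : ℝ → ℝ) (x y α : ℝ) : Prop :=
  x ∈ Ioo (-1) 1 ∧ y ∈ Ioo (-1) 1 ∧ y < x ∧ α ∈ Ioo 0 1 ∧
  deriv q x / q x + 2 / (x - y) + (k - 1) *
    ((deriv q x * (1 - x ^ 2) * α + q x * (-2 * x) * α) /
      (q x * (1 - x ^ 2) * α + q y * (1 - y ^ 2) * (1 - α))) = 0 ∧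
  deriv q y / q y - 2 / (x - y) + (k - 1) *
    ((deriv q y * (1 - y ^ 2) * (1 - α) + q y * (-2 * y) * (1 - α)) /
      (q x * (1 - x ^ 2) * α + q y * (1 - y ^ 2) * (1 - α))) = 0 ∧
  1 / α - 1 / (1 - α) + (k - 1) *
    ((q x * (1 - x ^ 2) - q y * (1 - y ^ 2)) /
      (q x * (1 - x ^ 2) * α + q y * (1 - y ^ 2) * (1 - α))) = 0

end

/-!
Write `k = n + 1`, `q(t) = λ(β₀ + β₁ t)` and `mᵢ = ∫ q(t) tⁱ dξ₁`.

*Reduction to one dimension.* By the symmetries of the sphere the information matrix of `ξ₁ ⊗ η̄` is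
block diagonal with determinant `(m₀ m₂ - m₁²) ((m₀ - m₂) / n)ⁿ` (`infoMatrix_invariantDesign`,
`momentMatrix_det`). The inequality `det A ≤ det B exp (tr (B⁻¹ A) - card)`, which is
`x ≤ exp (x - 1)` applied to eigenvalues, gives the equivalence theorem: `ξ₁ ⊗ η̄` is optimal among
all designs on the ball as soon as `q · sens ≤ n + 2` on `[-1, 1]`, where `sens` is the quadratic
polynomial `fᵀ M⁻¹ f` on the unit sphere (`IsMarginal.isLocallyDOptimal_of_sens_le`). Conversely, a
maximizer among the marginal designs satisfies this bound, by differentiating along mixtures with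
point masses (`IsMarginal.sens_le_of_isMax`). A maximizer exists by weak compactness, and every
optimal marginal design sits on the contact set `q · sens = n + 2` of any other one
(`IsLocallyDOptimalMarginal.ae_mem_contactSet`).

*Two support points.* Let `U = 1 / q`. The gap `h = U - sens / (n + 2)` is nonnegative on `[-1, 1]`
and vanishes on the contact set. By the growth condition `U''` is strictly increasing to the right
of the mode, so that `U''` is either strictly increasing or first decreasing and then increasing. In
both cases Rolle's theorem excludes three zeros of `h` (`IsRecipIntensity.not_three_zeros`): the
middle one would lie between two zeros of `h''`, where `h'' < 0`. A regular design has at least two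
support points, hence exactly two, and the weight at given points solves a strictly decreasing
equation; this yields uniqueness.

*Shape of the solution.* The equations of the theorem say that `h` vanishes at both support points
and `h'` at the interior ones. If the mode lies outside `[-1, 1]`, the support point on the side of
the mode is an endpoint: at an interior support point `h` has a double zero, which contradicts the
monotonicity of `U''` by Rolle's theorem or, for `k = 1`, the sign of `U'`. A solution of the
stationarity system produces two double zeros of `h`, whence `h ≥ 0`
(`IsRecipIntensity.nonneg_of_two_double_zeros`) and optimality. For `k = 1`, where the critical
equation is claimed to determine the second point, the left side minus the right side of that
equation is strictly monotone beyond the mode (`strictMonoOn_critical`); only where `U''` increases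
throughout, a direct comparison of slopes at `1` replaces this argument
(`IsOptimalPair.eq_of_eqUpperOne`).
-/

/-! ### A determinant bound for positive semidefinite matrices -/

/-- The bound `x ≤ exp (x - 1)`, multiplied over the eigenvalues. -/
theorem Matrix.PosSemidef.det_le_exp_trace_sub_card {ι : Type*} [Fintype ι] [DecidableEq ι]
    {A : Matrix ι ι ℝ} (hA : A.PosSemidef) :
    A.det ≤ Real.exp (A.trace - Fintype.card ι) := by
  have hd : A.det = ∏ i, hA.1.eigenvalues i := by
    simpa using hA.1.det_eq_prod_eigenvalues
  have ht : A.trace = ∑ i, hA.1.eigenvalues i := by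
    simpa using hA.1.trace_eq_sum_eigenvalues
  have hs : A.trace - Fintype.card ι = ∑ i, (hA.1.eigenvalues i - 1) := by
    rw [ht, Finset.sum_sub_distrib]; simp
  rw [hs, Real.exp_sum, hd]
  refine Finset.prod_le_prod (fun i _ => hA.eigenvalues_nonneg i) fun i _ => ?_
  linarith [Real.add_one_le_exp (hA.1.eigenvalues i - 1)]

open scoped Matrix in
/-- With equality for `A = B`: this says that `log det` lies below its tangent at `B`. -/
theorem Matrix.PosSemidef.det_le_det_mul_exp {ι : Type*} [Fintype ι] [DecidableEq ι]
    {A B : Matrix ι ι ℝ} (hA : A.PosSemidef) (hB : B.PosDef) :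
    A.det ≤ B.det * Real.exp ((B⁻¹ * A).trace - Fintype.card ι) := by
  open scoped MatrixOrder in
  obtain ⟨S, hS, hBS⟩ : ∃ S : Matrix ι ι ℝ, IsUnit S ∧ B = star S * S := by
    have := (CStarAlgebra.isStrictlyPositive_iff_eq_star_mul_self (a := B)).mp hB.isStrictlyPositive
    simpa using this
  have hSd : IsUnit S.det := (Matrix.isUnit_iff_isUnit_det S).mp hS
  have hC : (S⁻¹ᴴ * A * S⁻¹).PosSemidef := hA.conjTranspose_mul_mul_same S⁻¹
  have hBi : B⁻¹ = S⁻¹ * S⁻¹ᴴ := by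
    rw [hBS, Matrix.mul_inv_rev, Matrix.star_eq_conjTranspose, Matrix.conjTranspose_nonsing_inv]
  have htr : (S⁻¹ᴴ * A * S⁻¹).trace = (B⁻¹ * A).trace := by
    rw [hBi, Matrix.trace_mul_comm, Matrix.mul_assoc]
  have hdet : A.det = B.det * (S⁻¹ᴴ * A * S⁻¹).det := by
    have h0 : S.det ≠ 0 := hSd.ne_zero
    rw [hBS, Matrix.star_eq_conjTranspose]
    simp only [Matrix.det_mul, Matrix.det_conjTranspose, Matrix.det_nonsing_inv,
      Ring.inverse_eq_inv', star_trivial]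
    field_simp
  rw [hdet, ← htr]
  exact mul_le_mul_of_nonneg_left hC.det_le_exp_trace_sub_card hB.det_pos.le

/-! ### Quadratics below a unimodal function with monotone second derivative -/

/-- Taylor's formula with Lagrange remainder of order two, on either side of the base point. -/
theorem exists_taylor_two {f f' f'' : ℝ → ℝ} (hf : ∀ t, HasDerivAt f (f' t) t)
    (hf' : ∀ t, HasDerivAt f' (f'' t) t) {a b : ℝ} (hab : a ≠ b) :
    ∃ s ∈ Ioo (min a b) (max a b), f b = f a + f' a * (b - a) + f'' s * (b - a) ^ 2 / 2 := by
  have hne : b - a ≠ 0 := sub_ne_zero.mpr hab.symm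
  -- Subtract the quadratic with the right 1-jet at `a` and the right value at `b`.
  set M : ℝ := (f b - f a - f' a * (b - a)) / (b - a) ^ 2 with hM
  set G : ℝ → ℝ := fun t => f t - f a - f' a * (t - a) - M * (t - a) ^ 2 with hG
  set G' : ℝ → ℝ := fun t => f' t - f' a - M * (2 * (t - a)) with hG'
  have dG : ∀ t, HasDerivAt G (G' t) t := fun t => by
    have h1 := (hasDerivAt_id t).sub_const a
    have := (((hf t).sub_const (f a)).sub (h1.const_mul (f' a))).sub ((h1.pow 2).const_mul M)
    refine this.congr_deriv ?_
    simp [hG']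
  have dG' : ∀ t, HasDerivAt G' (f'' t - 2 * M) t := fun t => by
    have h1 := (hasDerivAt_id t).sub_const a
    have := ((hf' t).sub_const (f' a)).sub ((h1.const_mul 2).const_mul M)
    refine this.congr_deriv ?_
    ring
  have Ga : G a = 0 := by simp [hG]
  have Gb : G b = 0 := by simp only [hG, hM]; field_simp; ring
  have G'a : G' a = 0 := by simp [hG']
  have cont : ∀ s : Set ℝ, ContinuousOn G s := fun s t _ => (dG t).continuousAt.continuousWithinAt
  have cont' : ∀ s : Set ℝ, ContinuousOn G' s :=
    fun s t _ => (dG' t).continuousAt.continuousWithinAt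
  have key : ∃ s ∈ Ioo (min a b) (max a b), f'' s - 2 * M = 0 := by
    rcases lt_or_gt_of_ne hab with h | h
    · obtain ⟨r, hr, hr0⟩ := exists_hasDerivAt_eq_zero h (cont _) (Ga.trans Gb.symm)
        fun t _ => dG t
      obtain ⟨s, hs, hs0⟩ := exists_hasDerivAt_eq_zero hr.1 (cont' _) (G'a.trans hr0.symm)
        fun t _ => dG' t
      rw [min_eq_left h.le, max_eq_right h.le]
      exact ⟨s, ⟨hs.1, hs.2.trans hr.2⟩, hs0⟩
    · obtain ⟨r, hr, hr0⟩ := exists_hasDerivAt_eq_zero h (cont _) (Gb.trans Ga.symm)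
        fun t _ => dG t
      obtain ⟨s, hs, hs0⟩ := exists_hasDerivAt_eq_zero hr.2 (cont' _) (hr0.trans G'a.symm)
        fun t _ => dG' t
      rw [min_eq_right h.le, max_eq_left h.le]
      exact ⟨s, ⟨hr.1.trans hs.1, hs.2⟩, hs0⟩
  obtain ⟨s, hs, hs0⟩ := key
  refine ⟨s, hs, ?_⟩
  have : f'' s = 2 * M := by linarith
  rw [this, hM]; field_simp; ring

theorem neg_of_double_zero {h h1 h2 : ℝ → ℝ} (d : ∀ t, HasDerivAt h (h1 t) t)
    (d' : ∀ t, HasDerivAt h1 (h2 t) t) {a b : ℝ} (hab : a ≠ b) (ha : h a = 0) (ha1 : h1 a = 0)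
    (hneg : ∀ s ∈ Ioo (min a b) (max a b), h2 s < 0) : h b < 0 := by
  obtain ⟨s, hs, e⟩ := exists_taylor_two d d' hab
  have h0 : 0 < (b - a) ^ 2 := by have := sub_ne_zero.mpr hab.symm; positivity
  rw [e, ha, ha1]; nlinarith [hneg s hs]

theorem pos_of_double_zero {h h1 h2 : ℝ → ℝ} (d : ∀ t, HasDerivAt h (h1 t) t)
    (d' : ∀ t, HasDerivAt h1 (h2 t) t) {a b : ℝ} (hab : a ≠ b) (ha : h a = 0) (ha1 : h1 a = 0)
    (hpos : ∀ s ∈ Ioo (min a b) (max a b), 0 < h2 s) : 0 < h b := by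
  obtain ⟨s, hs, e⟩ := exists_taylor_two d d' hab
  have h0 : 0 < (b - a) ^ 2 := by have := sub_ne_zero.mpr hab.symm; positivity
  rw [e, ha, ha1]; nlinarith [hpos s hs]

theorem exists_deriv_zero_between {f f' : ℝ → ℝ} (d : ∀ t, HasDerivAt f (f' t) t) {a b : ℝ}
    (hab : a < b) (e : f a = f b) : ∃ r, a < r ∧ r < b ∧ f' r = 0 := by
  obtain ⟨r, hr, h⟩ := exists_hasDerivAt_eq_zero hab
    (fun t _ => (d t).continuousAt.continuousWithinAt) e fun t _ => d t
  exact ⟨r, hr.1, hr.2, h⟩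

/-- The reciprocal `U = 1 / q` of a unimodal intensity with mode `c`, with its first two
derivatives: `U` decreases up to `c` and increases afterwards, `U''` is strictly increasing on
`[c, ∞)` and strictly monotone in one of the two directions on `(-∞, c]`. -/
structure IsRecipIntensity (U U1 U2 : ℝ → ℝ) (c : ℝ) : Prop where
  pos : ∀ t, 0 < U t
  d1 : ∀ t, HasDerivAt U (U1 t) t
  d2 : ∀ t, HasDerivAt U1 (U2 t) t
  neg_left : ∀ t < c, U1 t < 0
  pos_right : ∀ t > c, 0 < U1 t
  mode : U1 c = 0
  right : StrictMonoOn U2 (Ici c)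
  left : StrictMonoOn U2 (Iic c) ∨ StrictAntiOn U2 (Iic c)

namespace IsRecipIntensity

variable {U U1 U2 : ℝ → ℝ} {c : ℝ} (H : IsRecipIntensity U U1 U2 c)
include H

theorem lt_of_anti_left (hl : StrictAntiOn U2 (Iic c)) {a b κ : ℝ} (ha : U2 a = κ) (hb : U2 b = κ)
    {t : ℝ} (h1 : a < t) (h2 : t < b) : U2 t < κ := by
  rcases le_total t c with h | h
  · exact ha ▸ hl (show a ∈ Iic c from h1.le.trans h) h h1
  · exact hb ▸ H.right h (show b ∈ Ici c from h.trans h2.le) h2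

theorem strictMono_of_left (hl : StrictMonoOn U2 (Iic c)) : StrictMono U2 :=
  hl.Iic_union_Ici H.right

/-- If `U''` takes a value twice, it is not strictly increasing, so it decreases up to the mode. -/
theorem strictAntiOn_of_eq {a b : ℝ} (hab : a < b) (e : U2 a = U2 b) : StrictAntiOn U2 (Iic c) :=
  H.left.resolve_left fun hl => (H.strictMono_of_left hl hab).ne e

theorem gt_left_of_eq {a b : ℝ} (hab : a < b) (e : U2 a = U2 b) {t : ℝ} (ht : t < a) :
    U2 a < U2 t := by
  have hl := H.strictAntiOn_of_eq hab e
  have hac : a ≤ c := by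
    by_contra! h
    exact (H.right h.le (h.trans hab).le hab).ne e
  exact hl (show t ∈ Iic c from ht.le.trans hac) hac ht

theorem gt_right_of_eq {a b : ℝ} (hab : a < b) (e : U2 a = U2 b) {t : ℝ} (ht : b < t) :
    U2 b < U2 t := by
  have hl := H.strictAntiOn_of_eq hab e
  have hac : c ≤ b := by
    by_contra! h
    exact (hl (hab.trans h).le h.le hab).ne e.symm
  exact H.right hac (show t ∈ Ici c from hac.trans ht.le) ht

end IsRecipIntensity

theorem deriv_zero_of_nonneg {h h1 : ℝ → ℝ} (d : ∀ t, HasDerivAt h (h1 t) t)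
    (hn : ∀ t ∈ Icc (-1 : ℝ) 1, 0 ≤ h t) {x : ℝ} (hx : x ∈ Ioo (-1 : ℝ) 1) (h0 : h x = 0) :
    h1 x = 0 := by
  have : IsLocalMin h x := by
    filter_upwards [Ioo_mem_nhds hx.1 hx.2] with t ht
    rw [h0]; exact hn t ⟨ht.1.le, ht.2.le⟩
  exact this.hasDerivAt_eq_zero (d x)

theorem HasDerivAt.nonneg_of_forall_le_right {f : ℝ → ℝ} {f' a b : ℝ} (hf : HasDerivAt f f' a)
    (hab : a < b) (hmin : ∀ t ∈ Icc a b, f a ≤ f t) : 0 ≤ f' := by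
  have hloc : IsLocalMinOn f (Icc a b) a := by
    filter_upwards [self_mem_nhdsWithin] with t ht using hmin t ht
  have := hloc.hasFDerivWithinAt_nonneg hf.hasFDerivAt.hasFDerivWithinAt
    (sub_mem_posTangentConeAt_of_segment_subset (segment_eq_Icc hab.le).subset)
  simp only [ContinuousLinearMap.toSpanSingleton_apply, smul_eq_mul] at this
  exact nonneg_of_mul_nonneg_right this (sub_pos.mpr hab)

theorem deriv_nonneg_left_of_nonneg {h h1 : ℝ → ℝ} (d : ∀ t, HasDerivAt h (h1 t) t)
    (hn : ∀ t ∈ Icc (-1 : ℝ) 1, 0 ≤ h t) {x : ℝ} (hx : x ∈ Ico (-1 : ℝ) 1) (h0 : h x = 0) :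
    0 ≤ h1 x :=
  (d x).nonneg_of_forall_le_right hx.2 fun t ht => h0 ▸ hn t ⟨hx.1.trans ht.1, ht.2⟩

theorem deriv_nonpos_right_of_nonneg {h h1 : ℝ → ℝ} (d : ∀ t, HasDerivAt h (h1 t) t)
    (hn : ∀ t ∈ Icc (-1 : ℝ) 1, 0 ≤ h t) {x : ℝ} (hx : x ∈ Ioc (-1 : ℝ) 1) (h0 : h x = 0) :
    h1 x ≤ 0 := by
  have := deriv_nonneg_left_of_nonneg (h := fun t => h (-t)) (h1 := fun t => - h1 (-t))
    (fun t => by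
      have := (d (-t)).comp t (hasDerivAt_neg t)
      simpa [Function.comp_def] using this)
    (fun t ht => hn (-t) ⟨by linarith [ht.2], by linarith [ht.1]⟩) (x := -x)
    ⟨by linarith [hx.2], by linarith [hx.1]⟩ (by simpa using h0)
  simpa using this

section zeros

variable {U U1 U2 h h1 : ℝ → ℝ} {c κ : ℝ}

/-- `h = U - p` with a quadratic `p` that stays below `U` on `[-1, 1]` cannot touch `U` at three
points there: three contacts give `h''` two zeros around the middle one, between which `h'' < 0`. -/
theorem IsRecipIntensity.not_three_zeros (H : IsRecipIntensity U U1 U2 c)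
    (d : ∀ t, HasDerivAt h (h1 t) t) (d' : ∀ t, HasDerivAt h1 (U2 t - κ) t)
    (hn : ∀ t ∈ Icc (-1 : ℝ) 1, 0 ≤ h t) {x y z : ℝ} (hx : -1 ≤ x) (hxy : x < y) (hyz : y < z)
    (hz : z ≤ 1) (h0x : h x = 0) (h0y : h y = 0) (h0z : h z = 0) : False := by
  have h1y := deriv_zero_of_nonneg d hn (x := y) ⟨by linarith, by linarith⟩ h0y
  obtain ⟨r, hxr, hry, h1r⟩ := exists_deriv_zero_between d hxy (h0x.trans h0y.symm)
  obtain ⟨r', hyr, hrz, h1r'⟩ := exists_deriv_zero_between d hyz (h0y.trans h0z.symm)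
  obtain ⟨s, hrs, hsy, hs⟩ := exists_deriv_zero_between d' hry (h1r.trans h1y.symm)
  obtain ⟨s', hys', hsr', hs'⟩ := exists_deriv_zero_between d' hyr (h1y.trans h1r'.symm)
  have es : U2 s = κ := by linarith
  have es' : U2 s' = κ := by linarith
  have hl := H.strictAntiOn_of_eq (hsy.trans hys') (es.trans es'.symm)
  have := neg_of_double_zero d d' hsy.ne' h0y h1y fun t ht => by
    rw [min_eq_right hsy.le, max_eq_left hsy.le] at ht
    exact sub_neg.mpr (H.lt_of_anti_left hl es es' ht.1 (ht.2.trans hys'))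
  linarith [hn s ⟨by linarith, by linarith⟩]

/-- If `U''` increases on `[-1, 1]`, a double zero of `h` has no zero to its right: by Rolle's
theorem `h''` would be negative next to the double zero. -/
theorem not_double_zero_left_of_strictMonoOn (hU : StrictMonoOn U2 (Icc (-1 : ℝ) 1))
    (d : ∀ t, HasDerivAt h (h1 t) t) (d' : ∀ t, HasDerivAt h1 (U2 t - κ) t)
    (hn : ∀ t ∈ Icc (-1 : ℝ) 1, 0 ≤ h t) {x y : ℝ} (hy : -1 ≤ y) (hyx : y < x) (hx : x ≤ 1)
    (h0y : h y = 0) (h0x : h x = 0) (h1y : h1 y = 0) : False := by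
  obtain ⟨r, hyr, hrx, h1r⟩ := exists_deriv_zero_between d hyx (h0y.trans h0x.symm)
  obtain ⟨s, hys, hsr, hs⟩ := exists_deriv_zero_between d' hyr (h1y.trans h1r.symm)
  have := neg_of_double_zero d d' hys.ne h0y h1y fun t ht => by
    rw [min_eq_left hys.le, max_eq_right hys.le] at ht
    have := hU ⟨by linarith [ht.1], by linarith [ht.2]⟩ ⟨by linarith, by linarith⟩ ht.2
    linarith
  linarith [hn s ⟨by linarith, by linarith⟩]

/-- The mirror image of `not_double_zero_left_of_strictMonoOn`. -/
theorem not_double_zero_right_of_strictAntiOn (hU : StrictAntiOn U2 (Icc (-1 : ℝ) 1))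
    (d : ∀ t, HasDerivAt h (h1 t) t) (d' : ∀ t, HasDerivAt h1 (U2 t - κ) t)
    (hn : ∀ t ∈ Icc (-1 : ℝ) 1, 0 ≤ h t) {x y : ℝ} (hy : -1 ≤ y) (hyx : y < x) (hx : x ≤ 1)
    (h0y : h y = 0) (h0x : h x = 0) (h1x : h1 x = 0) : False := by
  obtain ⟨r, hyr, hrx, h1r⟩ := exists_deriv_zero_between d hyx (h0y.trans h0x.symm)
  obtain ⟨s, hrs, hsx, hs⟩ := exists_deriv_zero_between d' hrx (h1r.trans h1x.symm)
  have := neg_of_double_zero d d' hsx.ne' h0x h1x fun t ht => by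
    rw [min_eq_right hsx.le, max_eq_left hsx.le] at ht
    have := hU ⟨by linarith, by linarith⟩ ⟨by linarith [ht.1], by linarith [ht.2]⟩ ht.1
    linarith
  linarith [hn s ⟨by linarith, by linarith⟩]

/-- A quadratic tangent to `U` at two points stays below `U`. -/
theorem IsRecipIntensity.nonneg_of_two_double_zeros (H : IsRecipIntensity U U1 U2 c)
    (d : ∀ t, HasDerivAt h (h1 t) t) (d' : ∀ t, HasDerivAt h1 (U2 t - κ) t)
    {x y : ℝ} (hyx : y < x) (h0y : h y = 0) (h0x : h x = 0) (h1y : h1 y = 0) (h1x : h1 x = 0)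
    (t : ℝ) : 0 ≤ h t := by
  obtain ⟨r, hyr, hrx, h1r⟩ := exists_deriv_zero_between d hyx (h0y.trans h0x.symm)
  obtain ⟨s, hys, hsr, hs⟩ := exists_deriv_zero_between d' hyr (h1y.trans h1r.symm)
  obtain ⟨s', hrs', hsx', hs'⟩ := exists_deriv_zero_between d' hrx (h1r.trans h1x.symm)
  have es : U2 s = κ := by linarith
  have es' : U2 s' = κ := by linarith
  have hss : s < s' := hsr.trans hrs'
  have hl := H.strictAntiOn_of_eq hss (es.trans es'.symm)
  have left : ∀ t ≤ s, 0 ≤ h t := fun t ht => by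
    rcases eq_or_ne y t with rfl | hne
    · exact h0y.ge
    refine (pos_of_double_zero d d' hne h0y h1y fun a ha => ?_).le
    have := H.gt_left_of_eq hss (es.trans es'.symm) (t := a) (ha.2.trans_le (max_le hys.le ht))
    linarith
  have right : ∀ t ≥ s', 0 ≤ h t := fun t ht => by
    rcases eq_or_ne x t with rfl | hne
    · exact h0x.ge
    refine (pos_of_double_zero d d' hne h0x h1x fun a ha => ?_).le
    have := H.gt_right_of_eq hss (es.trans es'.symm) (t := a)
      ((le_min hsx'.le ht).trans_lt ha.1)
    linarith
  by_contra! hneg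
  have hst : s < t := by by_contra! h; exact (left t h).not_gt hneg
  have hts : t < s' := by by_contra! h; exact (right t h).not_gt hneg
  -- On `(s, s')` the function is concave, so a negative value would propagate to an endpoint.
  rcases le_total (h1 t) 0 with hs1 | hs1
  · obtain ⟨a, ha, e⟩ := exists_taylor_two d d' hts.ne
    rw [min_eq_left hts.le, max_eq_right hts.le] at ha
    have := H.lt_of_anti_left hl es es' (hst.trans ha.1) ha.2
    have h2 := right s' le_rfl
    rw [e] at h2
    nlinarith [sq_nonneg (s' - t)]
  · obtain ⟨a, ha, e⟩ := exists_taylor_two d d' hst.ne'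
    rw [min_eq_right hst.le, max_eq_left hst.le] at ha
    have := H.lt_of_anti_left hl es es' ha.1 (ha.2.trans hts)
    have h2 := left s le_rfl
    rw [e] at h2
    nlinarith [sq_nonneg (s - t)]

end zeros

/-- Minimizing `U t / (1 + t)²`: past the mode, the left side minus the right side of the critical
equation `U' = 2 U / (1 + t)` is strictly increasing. Up to the factor `(1 + t)²` its derivative is
twice the value at `-1` of the quadratic Taylor polynomial of `U` at `t`, and that value is positive
because `U''` increases on `[c, t]`. -/
theorem strictMonoOn_critical {U U1 U2 : ℝ → ℝ} {c : ℝ} (pos : ∀ t, 0 < U t)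
    (d1 : ∀ t, HasDerivAt U (U1 t) t) (d2 : ∀ t, HasDerivAt U1 (U2 t) t)
    (pos_right : ∀ t > c, 0 < U1 t) (mode : U1 c = 0) (right : StrictMonoOn U2 (Ici c)) :
    StrictMonoOn (fun t => U1 t - 2 * U t / (1 + t)) (Ioi c ∩ Ioi (-1)) := by
  -- Half the numerator of the derivative: the Taylor polynomial at `s`, evaluated at `-1`.
  have E : ∀ s, c < s → -1 < s →
      0 < U s + U1 s * (-1 - s) + U2 s * (-1 - s) ^ 2 / 2 := fun s hcs hs => by
    have tay : ∀ r, c ≤ r → r < s → U r ≤ U s + U1 s * (r - s) + U2 s * (r - s) ^ 2 / 2 :=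
      fun r hr hrs => by
        obtain ⟨a, ha, e⟩ := exists_taylor_two d1 d2 hrs.ne'
        rw [min_eq_right hrs.le, max_eq_left hrs.le] at ha
        have := right (show a ∈ Ici c from hr.trans ha.1.le) hcs.le ha.2
        rw [e]; nlinarith [sq_nonneg (r - s)]
    rcases le_or_gt c (-1) with h | h
    · exact (pos _).trans_le (tay _ h hs)
    · have h1 := (pos c).trans_le (tay c le_rfl hcs)
      obtain ⟨a, ha, e⟩ := exists_hasDerivAt_eq_slope U1 U2 hcs
        (fun t _ => (d2 t).continuousAt.continuousWithinAt) fun t _ => d2 t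
      have h2 := right (show a ∈ Ici c from ha.1.le) hcs.le ha.2
      have h3 := pos_right s hcs
      have h4 : U1 s = U2 a * (s - c) := by
        rw [e, mode]; field_simp [(sub_pos.mpr hcs).ne']; ring
      have h5 : 0 < U2 a := by
        by_contra! hle
        nlinarith
      have h6 : U1 s ≤ U2 s * (s - c) := by nlinarith
      have h7 : 0 ≤ (c + 1) * (U2 s * (1 + c)) := by
        have : 0 < U2 s := h5.trans h2
        have : 0 < 1 + c := by linarith
        have : 0 < c + 1 := by linarith
        positivity
      nlinarith [mul_nonneg (show 0 ≤ c + 1 by linarith) (sub_nonneg.mpr h6)]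
  have hd : ∀ s, -1 < s → HasDerivAt (fun t => U1 t - 2 * U t / (1 + t))
      (U2 s - (2 * U1 s * (1 + s) - 2 * U s) / (1 + s) ^ 2) s := fun s hs => by
    have := (d2 s).sub (((d1 s).const_mul 2).div ((hasDerivAt_id s).const_add 1)
      (by simp only [id]; linarith))
    exact this.congr_deriv (by simp)
  rintro a ⟨hca, ha⟩ b - hab
  obtain ⟨s, hs, e⟩ := exists_hasDerivAt_eq_slope _ _ hab
    (fun t ht => (hd t (lt_of_lt_of_le ha ht.1)).continuousAt.continuousWithinAt)
    fun t ht => hd t (lt_trans ha ht.1)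
  have hs1 : -1 < s := lt_trans ha hs.1
  have h1s : 0 < 1 + s := by linarith
  have hp : 0 < U2 s - (2 * U1 s * (1 + s) - 2 * U s) / (1 + s) ^ 2 := by
    have := E s (lt_trans hca hs.1) hs1
    have e : U2 s - (2 * U1 s * (1 + s) - 2 * U s) / (1 + s) ^ 2 =
      2 * (U s + U1 s * (-1 - s) + U2 s * (-1 - s) ^ 2 / 2) / (1 + s) ^ 2 := by field_simp; ring
    rw [e]; positivity
  rw [e] at hp
  have := (div_pos_iff_of_pos_right (sub_pos.mpr hab)).mp hp
  simp only at this ⊢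
  linarith

/-- The critical equation `U' = 2 U / (1 + t)` determines the minimizer `x` of `U t / (1 + t)²` on
`(-1, 1]`, including the case that the minimum is attained at the endpoint `1`. -/
theorem eq_of_critical {U U1 U2 : ℝ → ℝ} {c : ℝ} (pos : ∀ t, 0 < U t)
    (d1 : ∀ t, HasDerivAt U (U1 t) t) (d2 : ∀ t, HasDerivAt U1 (U2 t) t)
    (neg_left : ∀ t < c, U1 t < 0) (pos_right : ∀ t > c, 0 < U1 t) (mode : U1 c = 0)
    (right : StrictMonoOn U2 (Ici c)) {x t : ℝ} (hx : x ∈ Ioc (-1 : ℝ) 1)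
    (ht : t ∈ Ioc (-1 : ℝ) 1) (hKx : U1 x ≤ 2 * U x / (1 + x))
    (hKx' : x < 1 → U1 x = 2 * U x / (1 + x)) (hKt : U1 t = 2 * U t / (1 + t)) : x = t := by
  have mono := strictMonoOn_critical pos d1 d2 pos_right mode right
  have gt : ∀ s, -1 < s → U1 s = 2 * U s / (1 + s) → c < s := fun s hs e => by
    have : 0 < U1 s := by
      have := pos s
      have : 0 < 1 + s := by linarith
      rw [e]; positivity
    by_contra! h
    rcases h.lt_or_eq with h | rfl
    · linarith [neg_left s h]
    · linarith
  have hct := gt t ht.1 hKt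
  rcases hx.2.lt_or_eq with h | rfl
  · have hcx := gt x hx.1 (hKx' h)
    refine mono.injOn ⟨hcx, hx.1⟩ ⟨hct, ht.1⟩ ?_
    linarith [hKx' h]
  · by_contra hne
    have hlt : t < 1 := lt_of_le_of_ne ht.2 (Ne.symm hne)
    have := mono ⟨hct, ht.1⟩ ⟨hct.trans hlt, hx.1⟩ hlt
    simp only at this
    linarith

/-! ### Two-point designs: sensitivity and critical equations -/

/-- The integral `∫ q(t) (1 - t²)` for the two-point marginal design with weight `α` at `x` and
`1 - α` at `y`: the total information carried by the coordinates other than the first. -/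
noncomputable def pairB (q : ℝ → ℝ) (x y α : ℝ) : ℝ :=
  q x * (1 - x ^ 2) * α + q y * (1 - y ^ 2) * (1 - α)

/-- The sensitivity `f(z)ᵀ M⁻¹ f(z)` at a point `z` of the unit sphere with first coordinate `t`,
for the invariant design in dimension `n + 1` with weight `α` at `x` and `1 - α` at `y`. -/
noncomputable def pairSens (n : ℕ) (q : ℝ → ℝ) (x y α t : ℝ) : ℝ :=
  (t - y) ^ 2 / (α * q x * (x - y) ^ 2) + (t - x) ^ 2 / ((1 - α) * q y * (x - y) ^ 2) +
    n * (1 - t ^ 2) / pairB q x y α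

/-- The derivative of `pairSens` in `t`; it is affine in `t`. -/
noncomputable def pairSensDeriv (n : ℕ) (q : ℝ → ℝ) (x y α t : ℝ) : ℝ :=
  2 * (t - y) / (α * q x * (x - y) ^ 2) + 2 * (t - x) / ((1 - α) * q y * (x - y) ^ 2) -
    2 * n * t / pairB q x y α

theorem hasDerivAt_pairSens (n : ℕ) (q : ℝ → ℝ) (x y α t : ℝ) :
    HasDerivAt (pairSens n q x y α) (pairSensDeriv n q x y α t) t := by
  have e1 := ((((hasDerivAt_id t).sub_const y).pow 2).div_const (α * q x * (x - y) ^ 2))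
  have e2 := ((((hasDerivAt_id t).sub_const x).pow 2).div_const ((1 - α) * q y * (x - y) ^ 2))
  have e3 := ((((hasDerivAt_id t).pow 2).const_sub 1).const_mul (n : ℝ)).div_const (pairB q x y α)
  refine ((e1.add e2).add e3).congr_deriv ?_
  simp only [pairSensDeriv, id]; ring

theorem hasDerivAt_pairSensDeriv (n : ℕ) (q : ℝ → ℝ) (x y α t : ℝ) :
    HasDerivAt (pairSensDeriv n q x y α) (pairSensDeriv n q x y α 1 - pairSensDeriv n q x y α 0)
      t := by
  have e1 := ((((hasDerivAt_id t).sub_const y).const_mul 2).div_const (α * q x * (x - y) ^ 2))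
  have e2 := ((((hasDerivAt_id t).sub_const x).const_mul 2).div_const
    ((1 - α) * q y * (x - y) ^ 2))
  have e3 := ((hasDerivAt_id t).const_mul (2 * n : ℝ)).div_const (pairB q x y α)
  refine ((e1.add e2).sub e3).congr_deriv ?_
  simp only [pairSensDeriv]; ring

/-- The two-point marginal design with weight `α` at `x` and `1 - α` at `y < x` satisfies the
condition of the equivalence theorem for D-optimality in dimension `k = n + 1`: its sensitivity
stays below `(n + 2) / q` on `[-1, 1]`, with equality at the two points. -/
structure IsOptimalPair (n : ℕ) (q : ℝ → ℝ) (x y α : ℝ) : Prop where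
  weight : α ∈ Ioo (0 : ℝ) 1
  ge : -1 ≤ y
  lt : y < x
  le : x ≤ 1
  reg : 1 ≤ n → 0 < pairB q x y α
  bound : ∀ t ∈ Icc (-1 : ℝ) 1, pairSens n q x y α t ≤ (n + 2) * (1 / q t)
  eq_x : pairSens n q x y α x = (n + 2) * (1 / q x)
  eq_y : pairSens n q x y α y = (n + 2) * (1 / q y)

/-- `1 / q` minus the normalized sensitivity; nonnegative on `[-1, 1]` for an optimal design. -/
noncomputable def pairGap (n : ℕ) (q : ℝ → ℝ) (x y α t : ℝ) : ℝ :=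
  1 / q t - pairSens n q x y α t / (n + 2)

section pair

variable {n : ℕ} {q U1 U2 : ℝ → ℝ} {c x y α : ℝ}

theorem hasDerivAt_pairGap (H : IsRecipIntensity (fun t => 1 / q t) U1 U2 c) (t : ℝ) :
    HasDerivAt (pairGap n q x y α) (U1 t - pairSensDeriv n q x y α t / (n + 2)) t :=
  (H.d1 t).sub ((hasDerivAt_pairSens n q x y α t).div_const _)

theorem hasDerivAt_pairGapDeriv (H : IsRecipIntensity (fun t => 1 / q t) U1 U2 c) (t : ℝ) :
    HasDerivAt (fun t => U1 t - pairSensDeriv n q x y α t / (n + 2))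
      (U2 t - (pairSensDeriv n q x y α 1 - pairSensDeriv n q x y α 0) / (n + 2)) t :=
  (H.d2 t).sub ((hasDerivAt_pairSensDeriv n q x y α t).div_const _)

theorem IsRecipIntensity.q_pos (H : IsRecipIntensity (fun t => 1 / q t) U1 U2 c) (t : ℝ) :
    0 < q t := one_div_pos.mp (H.pos t)

theorem IsRecipIntensity.deriv_eq (H : IsRecipIntensity (fun t => 1 / q t) U1 U2 c) (t : ℝ) :
    deriv q t = -U1 t * q t ^ 2 := by
  have h0 := (H.q_pos t).ne'
  have := (H.d1 t).inv (H.pos t).ne'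
  have e : (fun t => 1 / q t)⁻¹ = q := by ext; simp
  rw [e] at this
  rw [this.deriv]; field_simp

theorem IsOptimalPair.gap_nonneg (h : IsOptimalPair n q x y α) :
    ∀ t ∈ Icc (-1 : ℝ) 1, 0 ≤ pairGap n q x y α t := fun t ht => by
  rw [pairGap, sub_nonneg, div_le_iff₀ (by positivity), mul_comm]; exact h.bound t ht

theorem IsOptimalPair.gap_x (h : IsOptimalPair n q x y α) : pairGap n q x y α x = 0 := by
  rw [pairGap, h.eq_x]; field_simp; ring

theorem IsOptimalPair.gap_y (h : IsOptimalPair n q x y α) : pairGap n q x y α y = 0 := by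
  rw [pairGap, h.eq_y]; field_simp; ring

theorem pairSens_x (hX : 0 < q x) (hxy : y < x) :
    pairSens n q x y α x = 1 / (α * q x) + n * (1 - x ^ 2) / pairB q x y α := by
  have := (sub_pos.mpr hxy).ne'
  rw [pairSens, sub_self]; field_simp; ring

theorem pairSens_y (hY : 0 < q y) (hxy : y < x) :
    pairSens n q x y α y = 1 / ((1 - α) * q y) + n * (1 - y ^ 2) / pairB q x y α := by
  have := (sub_pos.mpr hxy).ne'
  have e : y - x = -(x - y) := by ring
  rw [pairSens, sub_self, e]; field_simp; ring

theorem pairSensDeriv_x (hxy : y < x) :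
    pairSensDeriv n q x y α x = 2 / (α * q x * (x - y)) - 2 * n * x / pairB q x y α := by
  have := (sub_pos.mpr hxy).ne'
  have e : 2 * (x - y) / (α * q x * (x - y) ^ 2) = 2 / (α * q x * (x - y)) := by
    rw [pow_two, ← mul_assoc, mul_div_mul_right _ _ this]
  rw [pairSensDeriv, sub_self, e]; simp

theorem pairSensDeriv_y (hxy : y < x) :
    pairSensDeriv n q x y α y = -2 / ((1 - α) * q y * (x - y)) - 2 * n * y / pairB q x y α := by
  have := (sub_pos.mpr hxy).ne'
  have e : 2 * (y - x) / ((1 - α) * q y * (x - y) ^ 2) = -2 / ((1 - α) * q y * (x - y)) := by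
    rw [show 2 * (y - x) = -2 * (x - y) by ring, pow_two, ← mul_assoc, mul_div_mul_right _ _ this]
  rw [pairSensDeriv, sub_self, e]; simp

theorem IsOptimalPair.weight_of_x_eq_one (h : IsOptimalPair n q x y α) (hX : 0 < q x)
    (hx : x = 1) : α = 1 / (n + 2) := by
  have e := h.eq_x
  have h1 := h.weight.1.ne'
  rw [pairSens_x hX h.lt, hx] at e
  rw [hx] at hX
  field_simp at e ⊢
  simp at e
  linarith

theorem IsOptimalPair.weight_of_y_eq_neg_one (h : IsOptimalPair n q x y α) (hY : 0 < q y)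
    (hy : y = -1) : α = (n + 1) / (n + 2) := by
  have e := h.eq_y
  have h1 := (sub_pos.mpr h.weight.2).ne'
  rw [pairSens_y hY h.lt, hy] at e
  rw [hy] at hY
  field_simp at e ⊢
  simp at e
  linarith

theorem IsOptimalPair.neg_one_lt (h : IsOptimalPair n q x y α) (hn : 1 ≤ n) (hx : x = 1) :
    -1 < y := by
  refine h.ge.lt_of_ne fun hy => ?_
  have := h.reg hn
  rw [pairB, hx, ← hy] at this
  norm_num at this

theorem IsOptimalPair.lt_one (h : IsOptimalPair n q x y α) (hn : 1 ≤ n) (hy : y = -1) :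
    x < 1 := by
  refine h.le.lt_of_ne fun hx => ?_
  have := h.reg hn
  rw [pairB, hx, hy] at this
  norm_num at this

theorem IsOptimalPair.deriv_x (h : IsOptimalPair n q x y α)
    (H : IsRecipIntensity (fun t => 1 / q t) U1 U2 c) (hx : x < 1) :
    U1 x = pairSensDeriv n q x y α x / (n + 2) :=
  sub_eq_zero.mp (deriv_zero_of_nonneg (hasDerivAt_pairGap H) h.gap_nonneg
    ⟨h.ge.trans_lt h.lt, hx⟩ h.gap_x)

theorem IsOptimalPair.deriv_y (h : IsOptimalPair n q x y α)
    (H : IsRecipIntensity (fun t => 1 / q t) U1 U2 c) (hy : -1 < y) :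
    U1 y = pairSensDeriv n q x y α y / (n + 2) :=
  sub_eq_zero.mp (deriv_zero_of_nonneg (hasDerivAt_pairGap H) h.gap_nonneg
    ⟨hy, h.lt.trans_le h.le⟩ h.gap_y)

theorem IsOptimalPair.deriv_x_le (h : IsOptimalPair n q x y α)
    (H : IsRecipIntensity (fun t => 1 / q t) U1 U2 c) :
    U1 x ≤ pairSensDeriv n q x y α x / (n + 2) :=
  sub_nonpos.mp (deriv_nonpos_right_of_nonneg (hasDerivAt_pairGap H) h.gap_nonneg
    ⟨h.ge.trans_lt h.lt, h.le⟩ h.gap_x)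

theorem IsOptimalPair.deriv_y_ge (h : IsOptimalPair n q x y α)
    (H : IsRecipIntensity (fun t => 1 / q t) U1 U2 c) :
    pairSensDeriv n q x y α y / (n + 2) ≤ U1 y :=
  sub_nonneg.mp (deriv_nonneg_left_of_nonneg (hasDerivAt_pairGap H) h.gap_nonneg
    ⟨h.ge, h.lt.trans_le h.le⟩ h.gap_y)

theorem pairSensDeriv_y_of_x_eq_one (hY : 0 < q y) (hx : x = 1) (hα : α = 1 / (n + 2))
    (hy : -1 < y) (hy1 : y < 1) :
    pairSensDeriv n q x y α y / (n + 2) =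
      -(2 * (1 + (n + 1) * y) / ((n + 1) * (1 - y ^ 2))) / q y := by
  subst hx
  have h1 : 1 - y ≠ 0 := by linarith
  have h2 : 1 + y ≠ 0 := by linarith
  have h4 : 1 - y ^ 2 ≠ 0 := by
    rw [show 1 - y ^ 2 = (1 - y) * (1 + y) by ring]; exact mul_ne_zero h1 h2
  have h5 : 1 - α = (n + 1) / (n + 2) := by rw [hα]; field_simp; ring
  rw [pairSensDeriv_y hy1, pairB, h5]
  have e : (1:ℝ) - 1 ^ 2 = 0 := by norm_num
  rw [e]
  simp only [mul_zero, zero_mul, zero_add]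
  field_simp
  ring

theorem pairSensDeriv_x_of_y_eq_neg_one (hX : 0 < q x) (hy : y = -1)
    (hα : α = (n + 1) / (n + 2)) (hx : -1 < x) (hx1 : x < 1) :
    pairSensDeriv n q x y α x / (n + 2) =
      -(2 * (-1 + (n + 1) * x) / ((n + 1) * (1 - x ^ 2))) / q x := by
  subst hy
  have h1 : 1 - x ≠ 0 := by linarith
  have h2 : x + 1 ≠ 0 := by linarith
  have h4 : 1 - x ^ 2 ≠ 0 := by
    rw [show 1 - x ^ 2 = (1 - x) * (x + 1) by ring]; exact mul_ne_zero h1 h2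
  rw [pairSensDeriv_x hx, pairB, hα, sub_neg_eq_add]
  have e : (1:ℝ) - (-1) ^ 2 = 0 := by norm_num
  rw [e]
  simp only [mul_zero, zero_mul, add_zero]
  field_simp
  ring

theorem IsOptimalPair.eqUpper (h : IsOptimalPair n q x y α)
    (H : IsRecipIntensity (fun t => 1 / q t) U1 U2 c) (hx : x = 1) (hy : -1 < y) :
    EqUpper (n + 1) q y := by
  have hα := h.weight_of_x_eq_one (H.q_pos x) hx
  have hY := H.q_pos y
  have e := h.deriv_y H hy
  rw [pairSensDeriv_y_of_x_eq_one hY hx hα hy (hx ▸ h.lt)] at e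
  rw [EqUpper, H.deriv_eq, e]
  push_cast
  field_simp

theorem IsOptimalPair.eqLower (h : IsOptimalPair n q x y α)
    (H : IsRecipIntensity (fun t => 1 / q t) U1 U2 c) (hy : y = -1) (hx : x < 1) :
    EqLower (n + 1) q x := by
  have hα := h.weight_of_y_eq_neg_one (H.q_pos y) hy
  have hX := H.q_pos x
  have e := h.deriv_x H hx
  rw [pairSensDeriv_x_of_y_eq_neg_one hX hy hα (hy ▸ h.lt) hx] at e
  rw [EqLower, H.deriv_eq, e]
  push_cast
  field_simp

theorem IsRecipIntensity.eqUpperOne_iff (H : IsRecipIntensity (fun t => 1 / q t) U1 U2 c) (t : ℝ) :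
    EqUpperOne q t ↔ U1 t = -(2 * (1 / q t) / (1 - t)) := by
  have h0 := H.q_pos t
  rw [EqUpperOne, H.deriv_eq, show -U1 t * q t ^ 2 / q t = -U1 t * q t by field_simp,
    ← eq_div_iff h0.ne', neg_eq_iff_eq_neg, div_div, mul_one_div, div_div, mul_comm (q t)]

theorem IsRecipIntensity.eqLowerOne_iff (H : IsRecipIntensity (fun t => 1 / q t) U1 U2 c) (t : ℝ) :
    EqLowerOne q t ↔ U1 t = 2 * (1 / q t) / (1 + t) := by
  have h0 := H.q_pos t
  rw [EqLowerOne, H.deriv_eq, show -U1 t * q t ^ 2 / q t = -U1 t * q t by field_simp,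
    ← eq_div_iff h0.ne', neg_div, neg_div, neg_inj, div_div, mul_one_div, div_div,
    mul_comm (q t)]

theorem pairSensDeriv_x_of_y_eq_neg_one_zero (hX : 0 < q x) (hy : y = -1) (hx : -1 < x)
    (hα : α = 1 / 2) : pairSensDeriv 0 q x y α x / 2 = 2 * (1 / q x) / (1 + x) := by
  subst hy
  have h2 : 1 + x ≠ 0 := by linarith
  rw [pairSensDeriv_x hx, hα, sub_neg_eq_add, add_comm x]
  field_simp
  simp

theorem pairSensDeriv_y_of_x_eq_one_zero (hY : 0 < q y) (hx : x = 1) (hy : y < 1)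
    (hα : α = 1 / 2) : pairSensDeriv 0 q x y α y / 2 = -(2 * (1 / q y) / (1 - y)) := by
  subst hx
  have h2 : 1 - y ≠ 0 := by linarith
  rw [pairSensDeriv_y hy, hα]
  norm_num
  field_simp

/-- For `k = 1` and an optimal pair with left point `-1`, the critical equation of the right point
has no solution besides that point. -/
theorem IsOptimalPair.eq_of_eqLowerOne (h : IsOptimalPair 0 q x y α)
    (H : IsRecipIntensity (fun t => 1 / q t) U1 U2 c) (hy : y = -1) {t : ℝ}
    (ht : t ∈ Ioc (-1 : ℝ) 1) (e : EqLowerOne q t) : x = t := by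
  have hα : α = 1 / 2 := by simpa using h.weight_of_y_eq_neg_one (H.q_pos y) hy
  have hx : -1 < x := hy ▸ h.lt
  have hs := pairSensDeriv_x_of_y_eq_neg_one_zero (H.q_pos x) hy hx hα
  refine eq_of_critical H.pos H.d1 H.d2 H.neg_left H.pos_right H.mode H.right ⟨hx, h.le⟩ ht ?_ ?_
    ((H.eqLowerOne_iff t).mp e)
  · have := h.deriv_x_le H
    rw [← hs]; simpa using this
  · intro hx1
    have := h.deriv_x H hx1
    rw [← hs]; simpa using this

theorem IsOptimalPair.eqLowerOne (h : IsOptimalPair 0 q x y α)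
    (H : IsRecipIntensity (fun t => 1 / q t) U1 U2 c) (hy : y = -1) (hx1 : x < 1) :
    EqLowerOne q x := by
  have hα : α = 1 / 2 := by simpa using h.weight_of_y_eq_neg_one (H.q_pos y) hy
  have hx : -1 < x := hy ▸ h.lt
  have hs := pairSensDeriv_x_of_y_eq_neg_one_zero (H.q_pos x) hy hx hα
  have := h.deriv_x H hx1
  rw [H.eqLowerOne_iff, ← hs]; simpa using this

theorem IsOptimalPair.eqUpperOne (h : IsOptimalPair 0 q x y α)
    (H : IsRecipIntensity (fun t => 1 / q t) U1 U2 c) (hx : x = 1) (hy : -1 < y) :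
    EqUpperOne q y := by
  have hα : α = 1 / 2 := by simpa using h.weight_of_x_eq_one (H.q_pos x) hx
  have hs := pairSensDeriv_y_of_x_eq_one_zero (H.q_pos y) hx (hx ▸ h.lt) hα
  have := h.deriv_y H hy
  rw [H.eqUpperOne_iff, ← hs]; simpa using this

/-- If `U''` increases, `h''` changes sign from negative to positive between a double zero of `h`
and a later zero at `1`, so that `h` arrives there increasing. -/
theorem deriv_one_pos_of_double_zero {h h1 : ℝ → ℝ} {κ t : ℝ} (hU : StrictMono U2)
    (d : ∀ t, HasDerivAt h (h1 t) t) (d' : ∀ t, HasDerivAt h1 (U2 t - κ) t) (ht : t < 1)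
    (h0 : h t = 0) (h1t : h1 t = 0) (h01 : h 1 = 0) : 0 < h1 1 := by
  obtain ⟨r, htr, hr1, h1r⟩ := exists_deriv_zero_between d ht (h0.trans h01.symm)
  obtain ⟨s, hts, hsr, hs⟩ := exists_deriv_zero_between d' htr (h1t.trans h1r.symm)
  obtain ⟨a, ha, e⟩ := exists_hasDerivAt_eq_slope _ _ hr1
    (fun t _ => (d' t).continuousAt.continuousWithinAt) fun t _ => d' t
  have h2 := hU (hsr.trans ha.1)
  rw [h1r, sub_zero] at e
  have h3 : 0 < h1 1 / (1 - r) := by rw [← e]; linarith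
  exact (div_pos_iff_of_pos_right (sub_pos.mpr hr1)).mp h3

/-- The mirror image of `IsOptimalPair.eq_of_eqLowerOne`. If `U''` decreases to the left of the
mode, reflection applies. If `U''` increases throughout, a critical point `t` would force
`U'(1) > 2 U(1) / (1 - t) ≥ U(1)`, whereas the optimal pair, which then is `{1, -1}`, has
`U'(1) ≤ U(1)`. -/
theorem IsOptimalPair.eq_of_eqUpperOne (h : IsOptimalPair 0 q x y α)
    (H : IsRecipIntensity (fun t => 1 / q t) U1 U2 c) (hx : x = 1) {t : ℝ}
    (ht : t ∈ Ico (-1 : ℝ) 1) (e : EqUpperOne q t) : y = t := by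
  have hα : α = 1 / 2 := by simpa using h.weight_of_x_eq_one (H.q_pos x) hx
  have hy : y < 1 := hx ▸ h.lt
  have hs := pairSensDeriv_y_of_x_eq_one_zero (H.q_pos y) hx hy hα
  have et := (H.eqUpperOne_iff t).mp e
  rcases H.left with hl | hl
  · exfalso
    have hmono := H.strictMono_of_left hl
    have hyl : y = -1 := by
      by_contra hne
      have hy1 : -1 < y := lt_of_le_of_ne h.ge (Ne.symm hne)
      exact not_double_zero_left_of_strictMonoOn (hmono.strictMonoOn _) (hasDerivAt_pairGap H)
        (hasDerivAt_pairGapDeriv H) h.gap_nonneg h.ge h.lt h.le h.gap_y h.gap_x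
        (sub_eq_zero.mpr (h.deriv_y H hy1))
    have hle := h.deriv_x_le H
    rw [pairSensDeriv_x h.lt, hα, hx, hyl] at hle
    have hq1 := H.q_pos 1
    have hle1 : U1 1 ≤ 1 / q 1 := by
      refine hle.trans_eq ?_
      norm_num
      field_simp
    have h1t : 0 < 1 - t := sub_pos.mpr ht.2
    -- The quadratic through `(1, U 1)` that touches `U` at `t`.
    have d : ∀ s, HasDerivAt (fun s => 1 / q s -
        (1 / q t * (s - 1) ^ 2 + 1 / q 1 * (s - t) ^ 2) / (1 - t) ^ 2)
        (U1 s - (1 / q t * (2 * (s - 1)) + 1 / q 1 * (2 * (s - t))) / (1 - t) ^ 2) s := fun s => by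
      refine ((H.d1 s).sub ((((((hasDerivAt_id s).sub_const 1).pow 2).const_mul (1 / q t)).add
        ((((hasDerivAt_id s).sub_const t).pow 2).const_mul (1 / q 1))).div_const
        ((1 - t) ^ 2))).congr_deriv ?_
      simp only [id]; ring
    have d' : ∀ s, HasDerivAt (fun s => U1 s - (1 / q t * (2 * (s - 1)) + 1 / q 1 * (2 * (s - t))) /
        (1 - t) ^ 2) (U2 s - (1 / q t * 2 + 1 / q 1 * 2) / (1 - t) ^ 2) s := fun s => by
      refine ((H.d2 s).sub ((((((hasDerivAt_id s).sub_const 1).const_mul 2).const_mul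
        (1 / q t)).add ((((hasDerivAt_id s).sub_const t).const_mul 2).const_mul
        (1 / q 1))).div_const ((1 - t) ^ 2))).congr_deriv ?_
      ring
    have hqt := H.q_pos t
    have := deriv_one_pos_of_double_zero hmono d d' ht.2 (by field_simp; ring)
      (by rw [et]; field_simp; ring) (by field_simp; ring)
    have h2 : (1 / q t * (2 * (1 - 1)) + 1 / q 1 * (2 * (1 - t))) / (1 - t) ^ 2 =
      1 / q 1 * (2 / (1 - t)) := by field_simp; ring
    rw [h2] at this
    have h3 : 1 ≤ 2 / (1 - t) := by rw [le_div_iff₀ h1t]; linarith [ht.1]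
    have h4 : 0 < 1 / q 1 := H.pos 1
    nlinarith
  · have := eq_of_critical (U := fun s => 1 / q (-s)) (U1 := fun s => -U1 (-s))
      (U2 := fun s => U2 (-s)) (c := -c) (x := -y) (t := -t) (fun s => H.pos (-s))
      (fun s => by simpa [Function.comp_def] using (H.d1 (-s)).comp s (hasDerivAt_neg s))
      (fun s => (((H.d2 (-s)).comp s (hasDerivAt_neg s)).neg).congr_deriv (by simp))
      (fun s hs => neg_lt_zero.mpr (H.pos_right (-s) (by linarith)))
      (fun s hs => neg_pos.mpr (H.neg_left (-s) (by linarith)))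
      (by simp [H.mode])
      (fun a ha b hb hab => hl (show -b ∈ Iic c by simp only [mem_Iic, mem_Ici] at *; linarith)
        (show -a ∈ Iic c by simp only [mem_Iic, mem_Ici] at *; linarith) (neg_lt_neg hab))
      ⟨by linarith, by linarith [h.ge]⟩ ⟨by linarith [ht.2], by linarith [ht.1]⟩ ?_ ?_ ?_
    · linarith
    · have := h.deriv_y_ge H
      simp only [CharP.cast_eq_zero, zero_add, hs] at this
      simp only [neg_neg, ← sub_eq_add_neg]
      linarith
    · intro hy1
      have := h.deriv_y H (by linarith)
      simp only [CharP.cast_eq_zero, zero_add, hs] at this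
      simp only [neg_neg, ← sub_eq_add_neg]
      linarith
    · simp only [neg_neg, ← sub_eq_add_neg]
      linarith

end pair

/-! ### Two-point designs: weights, stationarity system and monotone critical equations -/

section pair

variable {n : ℕ} {q U1 U2 : ℝ → ℝ} {c x y α : ℝ}

/-- Equality of the normalized sensitivities at the two points, the equation for the weight. -/
theorem IsOptimalPair.weight_eq (h : IsOptimalPair n q x y α) (hq : ∀ t, 0 < q t) :
    1 / α - 1 / (1 - α) + n * ((q x * (1 - x ^ 2) - q y * (1 - y ^ 2)) / pairB q x y α) = 0 := by
  have hX := hq x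
  have hY := hq y
  have hα := h.weight.1
  have hα' := sub_pos.mpr h.weight.2
  have ex := h.eq_x
  have ey := h.eq_y
  rw [pairSens_x hX h.lt] at ex
  rw [pairSens_y hY h.lt] at ey
  have ex' := congrArg (fun r => r * q x) ex
  have ey' := congrArg (fun r => r * q y) ey
  simp only [add_mul] at ex' ey'
  rw [show 1 / (α * q x) * q x = 1 / α by field_simp,
    show (n : ℝ) * (1 / q x) * q x + 2 * (1 / q x) * q x = n + 2 by field_simp] at ex'
  rw [show 1 / ((1 - α) * q y) * q y = 1 / (1 - α) by field_simp,
    show (n : ℝ) * (1 / q y) * q y + 2 * (1 / q y) * q y = n + 2 by field_simp] at ey'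
  have : n * ((q x * (1 - x ^ 2) - q y * (1 - y ^ 2)) / pairB q x y α) =
    n * (1 - x ^ 2) / pairB q x y α * q x - n * (1 - y ^ 2) / pairB q x y α * q y := by ring
  rw [this]; linarith

/-- The weight equation has at most one solution, its left side being strictly decreasing. -/
theorem IsOptimalPair.weight_unique {α' : ℝ} (h : IsOptimalPair n q x y α)
    (h' : IsOptimalPair n q x y α') (hq : ∀ t, 0 < q t) : α = α' := by
  wlog hlt : α < α' generalizing α α'
  · by_contra hne
    exact hne (this h' h (lt_of_le_of_ne (not_lt.mp hlt) (Ne.symm hne))).symm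
  exfalso
  have e := h.weight_eq hq
  have e' := h'.weight_eq hq
  have hα := h.weight.1
  have hα' := h'.weight.1
  have hβ := sub_pos.mpr h.weight.2
  have hβ' := sub_pos.mpr h'.weight.2
  have i1 : 1 / α' < 1 / α := one_div_lt_one_div_of_lt hα hlt
  have i2 : 1 / (1 - α) < 1 / (1 - α') := one_div_lt_one_div_of_lt hβ' (by linarith)
  have i3 : n * ((q x * (1 - x ^ 2) - q y * (1 - y ^ 2)) / pairB q x y α') ≤
      n * ((q x * (1 - x ^ 2) - q y * (1 - y ^ 2)) / pairB q x y α) := by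
    rcases Nat.eq_zero_or_pos n with rfl | hn
    · simp
    refine mul_le_mul_of_nonneg_left ?_ n.cast_nonneg
    rw [div_le_div_iff₀ (h'.reg hn) (h.reg hn), pairB, pairB]
    nlinarith [mul_nonneg (sub_nonneg.mpr hlt.le)
      (sq_nonneg (q x * (1 - x ^ 2) - q y * (1 - y ^ 2)))]
  linarith

/-- The left side of the first stationarity equation, with `q' = -u q²`, in terms of the
sensitivity: it vanishes when the sensitivity at `x` is `(n + 2) / q` and its derivative is
`(n + 2) u`. -/
theorem interior_eq_x (hX : 0 < q x) (hα : 0 < α) (hB : 0 < pairB q x y α) (hyx : y < x) (u : ℝ) :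
    (-u * q x ^ 2) / q x + 2 / (x - y) + n *
      (((-u * q x ^ 2) * (1 - x ^ 2) * α + q x * (-2 * x) * α) / pairB q x y α) =
    α * q x * (pairSensDeriv n q x y α x - pairSens n q x y α x * q x * u) := by
  have := (sub_pos.mpr hyx).ne'
  rw [pairSensDeriv_x hyx, pairSens_x hX hyx]
  field_simp
  ring

/-- The second stationarity equation, rewritten like the first in `interior_eq_x`. -/
theorem interior_eq_y (hY : 0 < q y) (hα : α < 1) (hB : 0 < pairB q x y α) (hyx : y < x) (u : ℝ) :
    (-u * q y ^ 2) / q y - 2 / (x - y) + n *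
      (((-u * q y ^ 2) * (1 - y ^ 2) * (1 - α) + q y * (-2 * y) * (1 - α)) / pairB q x y α) =
    (1 - α) * q y * (pairSensDeriv n q x y α y - pairSens n q x y α y * q y * u) := by
  have := (sub_pos.mpr hyx).ne'
  have := sub_pos.mpr hα
  rw [pairSensDeriv_y hyx, pairSens_y hY hyx]
  field_simp
  ring

theorem pairB_pos (hq : ∀ t, 0 < q t) (hx : x ∈ Ioo (-1 : ℝ) 1) (hy : y ∈ Ioo (-1 : ℝ) 1)
    (hα : α ∈ Ioo (0 : ℝ) 1) : 0 < pairB q x y α := by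
  have h1 : 0 < 1 - x ^ 2 := by nlinarith [hx.1, hx.2]
  have h2 : 0 < 1 - y ^ 2 := by nlinarith [hy.1, hy.2]
  have h3 := hα.1
  have h4 := sub_pos.mpr hα.2
  have := hq x
  have := hq y
  rw [pairB]; positivity

theorem IsOptimalPair.interiorSolution (h : IsOptimalPair n q x y α)
    (H : IsRecipIntensity (fun t => 1 / q t) U1 U2 c) (hy : -1 < y) (hx : x < 1) :
    InteriorSolution (n + 1) q x y α := by
  have hxI : x ∈ Ioo (-1 : ℝ) 1 := ⟨hy.trans h.lt, hx⟩
  have hyI : y ∈ Ioo (-1 : ℝ) 1 := ⟨hy, h.lt.trans hx⟩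
  have hB := pairB_pos H.q_pos hxI hyI h.weight
  have hX := H.q_pos x
  have hY := H.q_pos y
  have hn : (n : ℝ) + 2 ≠ 0 := by positivity
  refine ⟨hxI, hyI, h.lt, h.weight, ?_, ?_, ?_⟩
  · have := interior_eq_x (n := n) hX h.weight.1 hB h.lt (U1 x)
    rw [H.deriv_eq]
    push_cast
    rw [add_sub_cancel_right]
    refine this.trans ?_
    rw [h.eq_x, h.deriv_x H hx]
    field_simp
    simp
  · have := interior_eq_y (n := n) hY h.weight.2 hB h.lt (U1 y)
    rw [H.deriv_eq]
    push_cast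
    rw [add_sub_cancel_right]
    refine this.trans ?_
    rw [h.eq_y, h.deriv_y H hy]
    field_simp
    simp
  · have := h.weight_eq H.q_pos
    push_cast
    rw [add_sub_cancel_right]
    exact this

/-- A solution of the stationarity system makes the sensitivity tangent to `(n + 2) / q` at both
points, and then it stays below `(n + 2) / q`. -/
theorem IsRecipIntensity.isOptimalPair (H : IsRecipIntensity (fun t => 1 / q t) U1 U2 c)
    (h : InteriorSolution (n + 1) q x y α) : IsOptimalPair n q x y α := by
  obtain ⟨hxI, hyI, hyx, hα, e1, e2, e3⟩ := h
  have hB := pairB_pos H.q_pos hxI hyI hα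
  have hX := H.q_pos x
  have hY := H.q_pos y
  have hn : (n : ℝ) + 2 ≠ 0 := by positivity
  have hα0 := hα.1
  have hα1 := sub_pos.mpr hα.2
  push_cast at e1 e2 e3
  rw [add_sub_cancel_right] at e1 e2 e3
  have sx : pairSens n q x y α x * q x =
      1 / α + n * (q x * (1 - x ^ 2) / pairB q x y α) := by
    rw [pairSens_x hX hyx]; field_simp
  have sy : pairSens n q x y α y * q y =
      1 / (1 - α) + n * (q y * (1 - y ^ 2) / pairB q x y α) := by
    rw [pairSens_y hY hyx]; field_simp
  have sub : pairSens n q x y α x * q x - pairSens n q x y α y * q y = 0 := by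
    rw [sx, sy, ← e3, pairB]; ring
  have sum : α * (pairSens n q x y α x * q x) + (1 - α) * (pairSens n q x y α y * q y) = n + 2 := by
    rw [sx, sy]
    have : α * (1 / α + n * (q x * (1 - x ^ 2) / pairB q x y α)) +
        (1 - α) * (1 / (1 - α) + n * (q y * (1 - y ^ 2) / pairB q x y α)) =
        2 + n * ((q x * (1 - x ^ 2) * α + q y * (1 - y ^ 2) * (1 - α)) / pairB q x y α) := by
      field_simp; ring
    rw [this, ← pairB, div_self hB.ne']; ring
  have ex : pairSens n q x y α x * q x = n + 2 := by linear_combination sum + (1 - α) * sub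
  have ey : pairSens n q x y α y * q y = n + 2 := by linear_combination sum - α * sub
  have eq_x : pairSens n q x y α x = (n + 2) * (1 / q x) := by
    rw [← ex]; field_simp
  have eq_y : pairSens n q x y α y = (n + 2) * (1 / q y) := by
    rw [← ey]; field_simp
  have dx : U1 x - pairSensDeriv n q x y α x / (n + 2) = 0 := by
    have := interior_eq_x (n := n) hX hα0 hB hyx (U1 x)
    rw [H.deriv_eq] at e1
    have h0 := this.symm.trans e1
    rw [ex] at h0
    have h1 := (mul_eq_zero.mp h0).resolve_left (by positivity)
    field_simp; linarith
  have dy : U1 y - pairSensDeriv n q x y α y / (n + 2) = 0 := by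
    have := interior_eq_y (n := n) hY hα.2 hB hyx (U1 y)
    rw [H.deriv_eq] at e2
    have h0 := this.symm.trans e2
    rw [ey] at h0
    have h1 := (mul_eq_zero.mp h0).resolve_left (by positivity)
    field_simp; linarith
  refine ⟨hα, hyI.1.le, hyx, hxI.2.le, fun _ => hB, fun t _ => ?_, eq_x, eq_y⟩
  have := H.nonneg_of_two_double_zeros (hasDerivAt_pairGap H) (hasDerivAt_pairGapDeriv H) hyx
    (by rw [pairGap, eq_y]; field_simp; ring) (by rw [pairGap, eq_x]; field_simp; ring) dy dx t
  rwa [pairGap, sub_nonneg, div_le_iff₀ (by positivity), mul_comm] at this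

/-- When the mode lies to the right of `[-1, 1]`, the right support point is `1`. -/
theorem IsOptimalPair.x_eq_one (h : IsOptimalPair n q x y α)
    (H : IsRecipIntensity (fun t => 1 / q t) U1 U2 c) (hc : 1 < c)
    (hn : n = 0 ∨ StrictAntiOn U2 (Iic c)) : x = 1 := by
  by_contra hne
  have hx := lt_of_le_of_ne h.le hne
  have dx := h.deriv_x H hx
  rcases hn with rfl | hl
  · have h1 := H.neg_left x (by linarith)
    rw [dx, pairSensDeriv_x h.lt] at h1
    have := H.q_pos x
    have := sub_pos.mpr h.lt
    have := h.weight.1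
    have h2 : 0 < 2 / (α * q x * (x - y)) := by positivity
    norm_num at h1
    linarith
  · exact not_double_zero_right_of_strictAntiOn
      (hl.mono fun t ht => show t ≤ c from ht.2.trans hc.le) (hasDerivAt_pairGap H)
      (hasDerivAt_pairGapDeriv H) h.gap_nonneg h.ge h.lt h.le h.gap_y h.gap_x
      (sub_eq_zero.mpr dx)

/-- When the mode lies to the left of `[-1, 1]`, the left support point is `-1`. -/
theorem IsOptimalPair.y_eq_neg_one (h : IsOptimalPair n q x y α)
    (H : IsRecipIntensity (fun t => 1 / q t) U1 U2 c) (hc : c < -1) : y = -1 := by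
  by_contra hne
  have hy := lt_of_le_of_ne h.ge (Ne.symm hne)
  exact not_double_zero_left_of_strictMonoOn
    (H.right.mono fun t ht => show c ≤ t from hc.le.trans ht.1) (hasDerivAt_pairGap H)
    (hasDerivAt_pairGapDeriv H) h.gap_nonneg h.ge h.lt h.le h.gap_y h.gap_x
    (sub_eq_zero.mpr (h.deriv_y H hy))

theorem IsOptimalPair.upperForm (h : IsOptimalPair n q x y α)
    (H : IsRecipIntensity (fun t => 1 / q t) U1 U2 c) (hx : x = 1) {ξ : Measure ℝ}
    (ex : ξ.real {x} = α) (ey : ξ.real {y} = 1 - α) : UpperForm (n + 1) q ξ x y := by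
  have hα := h.weight_of_x_eq_one (H.q_pos x) hx
  have hn : (n : ℝ) + 2 ≠ 0 := by positivity
  have e : ((n + 1 : ℕ) : ℝ) + 1 = n + 2 := by push_cast; ring
  refine ⟨hx, by rw [ex, hα, e], by rw [ey, hα, e]; push_cast; field_simp; ring, fun hk => ?_,
    fun hk => ?_⟩
  · have hy := h.neg_one_lt (by omega) hx
    exact ⟨⟨hy, hx ▸ h.lt⟩, h.eqUpper H hx hy⟩
  · obtain rfl : n = 0 := by omega
    refine ⟨fun t ht e => h.eq_of_eqUpperOne H hx ht e, fun hno => ?_⟩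
    by_contra hne
    have hy := lt_of_le_of_ne h.ge (Ne.symm hne)
    exact hno ⟨y, ⟨h.ge, hx ▸ h.lt⟩, h.eqUpperOne H hx hy⟩

theorem IsOptimalPair.lowerForm (h : IsOptimalPair n q x y α)
    (H : IsRecipIntensity (fun t => 1 / q t) U1 U2 c) (hy : y = -1) {ξ : Measure ℝ}
    (ex : ξ.real {x} = α) (ey : ξ.real {y} = 1 - α) : LowerForm (n + 1) q ξ x y := by
  have hα := h.weight_of_y_eq_neg_one (H.q_pos y) hy
  have hn : (n : ℝ) + 2 ≠ 0 := by positivity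
  have e : ((n + 1 : ℕ) : ℝ) + 1 = n + 2 := by push_cast; ring
  refine ⟨hy, by rw [ex, hα, e]; push_cast; rfl, by rw [ey, hα, e]; field_simp; ring, fun hk => ?_,
    fun hk => ?_⟩
  · have hx := h.lt_one (by omega) hy
    exact ⟨⟨hy ▸ h.lt, hx⟩, h.eqLower H hy hx⟩
  · obtain rfl : n = 0 := by omega
    refine ⟨fun t ht e => h.eq_of_eqLowerOne H hy ht e, fun hno => ?_⟩
    by_contra hne
    have hx := lt_of_le_of_ne h.le hne
    exact hno ⟨x, ⟨hy ▸ h.lt, h.le⟩, h.eqLowerOne H hy hx⟩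

end pair

theorem strictMonoOn_eqUpper_rhs {k : ℕ} (hk : 1 ≤ k) :
    StrictMonoOn (fun x : ℝ => 2 * (1 + k * x) / (k * (1 - x ^ 2))) (Ioo (-1) 1) := by
  have hk' : (1 : ℝ) ≤ k := by exact_mod_cast hk
  rintro a ⟨ha, ha'⟩ b ⟨hb, hb'⟩ hab
  have h1 : 0 < 1 - a ^ 2 := by nlinarith
  have h2 : 0 < 1 - b ^ 2 := by nlinarith
  simp only
  rw [div_lt_div_iff₀ (by positivity) (by positivity)]
  have key : (1 + k * a) * (1 - b ^ 2) < (1 + k * b) * (1 - a ^ 2) := by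
    have : (1 + k * b) * (1 - a ^ 2) - (1 + k * a) * (1 - b ^ 2) =
      (b - a) * ((k - 1) * (1 + a * b) + (1 + a) * (1 + b)) := by ring
    have h3 : 0 < (1 + a) * (1 + b) := mul_pos (by linarith) (by linarith)
    have h4 : 0 ≤ (k - 1) * (1 + a * b) := mul_nonneg (by linarith) (by nlinarith)
    nlinarith [mul_pos (sub_pos.mpr hab) (add_pos_of_nonneg_of_pos h4 h3)]
  nlinarith

theorem strictMonoOn_eqLower_rhs {k : ℕ} (hk : 1 ≤ k) :
    StrictMonoOn (fun x : ℝ => 2 * (-1 + k * x) / (k * (1 - x ^ 2))) (Ioo (-1) 1) := by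
  rintro a ⟨ha, ha'⟩ b ⟨hb, hb'⟩ hab
  have := strictMonoOn_eqUpper_rhs hk (a := -b) ⟨by linarith, by linarith⟩ (b := -a)
    ⟨by linarith, by linarith⟩ (by linarith)
  simp only [neg_sq] at this ⊢
  have e : ∀ t : ℝ, 2 * (-1 + k * t) / (k * (1 - t ^ 2)) =
    -(2 * (1 + k * -t) / (k * (1 - t ^ 2))) := fun t => by ring
  rw [e, e]; linarith

theorem subsingleton_of_antitone_of_strictMonoOn {f g : ℝ → ℝ} {s : Set ℝ} (hf : Antitone f)
    (hg : StrictMonoOn g s) : {x ∈ s | f x = g x}.Subsingleton := by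
  rintro a ⟨ha, ea⟩ b ⟨hb, eb⟩
  by_contra hne
  rcases lt_or_gt_of_ne hne with h | h
  · linarith [hf h.le, hg ha hb h]
  · linarith [hf h.le, hg hb ha h]

theorem upperUnique_of_antitone {q : ℝ → ℝ} (k : ℕ) (hq : Antitone fun t => deriv q t / q t) :
    UpperUnique k q := by
  refine ⟨fun hk => subsingleton_of_antitone_of_strictMonoOn hq
    (strictMonoOn_eqUpper_rhs (by omega)), fun _ =>
    subsingleton_of_antitone_of_strictMonoOn hq fun a ha b hb hab => ?_⟩
  exact div_lt_div_of_pos_left two_pos (sub_pos.mpr hb.2) (by linarith)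

theorem lowerUnique_of_antitone {q : ℝ → ℝ} (k : ℕ) (hq : Antitone fun t => deriv q t / q t) :
    LowerUnique k q := by
  refine ⟨fun hk => subsingleton_of_antitone_of_strictMonoOn hq
    (strictMonoOn_eqLower_rhs (by omega)), fun _ =>
    subsingleton_of_antitone_of_strictMonoOn hq fun a ha b hb hab => ?_⟩
  simp only [neg_div]
  have : 0 < 1 + a := by linarith [ha.1]
  exact neg_lt_neg (div_lt_div_of_pos_left two_pos this (by linarith))

/-! ### Second moments of the uniform distribution on the sphere -/

section sphere

variable {d : ℕ}

open scoped Pointwise in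
/-- Surface measure is invariant under linear isometries, because Lebesgue measure is and the
measure of a part of the sphere is that of the cone over it. -/
theorem map_toSphere_map_linearIsometryEquiv
    (e : EuclideanSpace ℝ (Fin d) ≃ₗᵢ[ℝ] EuclideanSpace ℝ (Fin d)) :
    ((volume : Measure (EuclideanSpace ℝ (Fin d))).toSphere.map Subtype.val).map e =
      (volume : Measure (EuclideanSpace ℝ (Fin d))).toSphere.map Subtype.val := by
  ext s hs
  have hm : Measurable (Subtype.val : Metric.sphere (0 : EuclideanSpace ℝ (Fin d)) 1 → _) :=
    measurable_subtype_coe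
  have he : Measurable e := e.continuous.measurable
  have hpre : e ⁻¹' (Ioo (0 : ℝ) 1 • (s ∩ Metric.sphere 0 1)) =
      Ioo (0 : ℝ) 1 • (e ⁻¹' s ∩ Metric.sphere 0 1) := by
    ext z
    simp only [mem_preimage, Set.mem_smul]
    constructor
    · rintro ⟨r, hr, w, ⟨hw, hw1⟩, hz⟩
      refine ⟨r, hr, e.symm w, ⟨by simpa using hw, by simpa using hw1⟩, ?_⟩
      rw [← map_smul, hz, e.symm_apply_apply]
    · rintro ⟨r, hr, w, ⟨hw, hw1⟩, rfl⟩
      exact ⟨r, hr, e w, ⟨hw, by simpa using hw1⟩, by simp⟩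
  rw [Measure.map_apply he hs, Measure.map_apply hm (he hs), Measure.map_apply hm hs,
    Measure.toSphere_apply' _ (hm (he hs)), Measure.toSphere_apply' _ (hm hs),
    Subtype.image_preimage_coe, Subtype.image_preimage_coe, inter_comm, inter_comm _ s, ← hpre]
  congr 1
  exact e.measurePreserving.measure_preimage_equiv (f := e.toMeasurableEquiv) _

theorem uniformSphere_map_linearIsometryEquiv
    (e : EuclideanSpace ℝ (Fin d) ≃ₗᵢ[ℝ] EuclideanSpace ℝ (Fin d)) :
    (uniformSphere d).map e = uniformSphere d := by
  unfold uniformSphere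
  split_ifs with h
  · rw [Measure.map_dirac' e.continuous.measurable, map_zero]
  · rw [Measure.map_smul, Measure.map_smul, map_toSphere_map_linearIsometryEquiv]

instance isProbabilityMeasure_uniformSphere : IsProbabilityMeasure (uniformSphere d) := by
  unfold uniformSphere
  split_ifs with h
  · infer_instance
  · have : NeZero d := ⟨h⟩
    have hm : Measurable (Subtype.val : Metric.sphere (0 : EuclideanSpace ℝ (Fin d)) 1 → _) :=
    measurable_subtype_coe
    constructor
    rw [Measure.map_apply hm .univ, preimage_univ, Measure.smul_apply, smul_eq_mul]
    refine ENNReal.inv_mul_cancel ?_ (measure_ne_top _ _)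
    rw [Ne, Measure.measure_univ_eq_zero]
    exact Measure.toSphere_ne_zero _

theorem ae_norm_uniformSphere (hd : d ≠ 0) : ∀ᵐ y ∂(uniformSphere d), ‖y‖ = 1 := by
  have hm : Measurable (Subtype.val : Metric.sphere (0 : EuclideanSpace ℝ (Fin d)) 1 → _) :=
    measurable_subtype_coe
  rw [uniformSphere, if_neg hd, ae_map_iff hm.aemeasurable (measurableSet_eq_fun
    continuous_norm.measurable measurable_const)]
  exact .of_forall fun y => by simp

theorem ae_norm_uniformSphere_le : ∀ᵐ y ∂(uniformSphere d), ‖y‖ ≤ 1 := by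
  rcases eq_or_ne d 0 with rfl | hd
  · exact .of_forall fun y => by simp [Subsingleton.elim y 0]
  · filter_upwards [ae_norm_uniformSphere hd] with y hy using hy.le

theorem integral_comp_isometry_uniformSphere
    (e : EuclideanSpace ℝ (Fin d) ≃ₗᵢ[ℝ] EuclideanSpace ℝ (Fin d))
    (f : EuclideanSpace ℝ (Fin d) → ℝ) :
    ∫ y, f (e y) ∂(uniformSphere d) = ∫ y, f y ∂(uniformSphere d) := by
  conv_rhs => rw [← uniformSphere_map_linearIsometryEquiv e]
  exact (integral_map_equiv e.toMeasurableEquiv f).symm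

theorem integral_coord_uniformSphere (i : Fin d) : ∫ y, y i ∂(uniformSphere d) = 0 := by
  have := integral_comp_isometry_uniformSphere (LinearIsometryEquiv.neg ℝ)
    fun y : EuclideanSpace ℝ (Fin d) => y i
  simp only [LinearIsometryEquiv.coe_neg, PiLp.neg_apply, integral_neg] at this
  linarith

theorem integral_coord_mul_coord_uniformSphere {i j : Fin d} (hij : i ≠ j) :
    ∫ y, y i * y j ∂(uniformSphere d) = 0 := by
  have := integral_comp_isometry_uniformSphere (LinearIsometryEquiv.piLpCongrRight 2
    -- The reflection in the hyperplane orthogonal to the `i`-th axis.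
    fun l : Fin d => if l = i then LinearIsometryEquiv.neg ℝ else LinearIsometryEquiv.refl ℝ ℝ)
    fun y : EuclideanSpace ℝ (Fin d) => y i * y j
  simp [LinearIsometryEquiv.piLpCongrRight_apply, hij.symm, integral_neg] at this
  linarith

theorem integrable_coord_sq_uniformSphere (i : Fin d) :
    Integrable (fun y => y i ^ 2) (uniformSphere d) := by
  refine Integrable.of_bound (C := 1) (by fun_prop) ?_
  filter_upwards [ae_norm_uniformSphere_le] with y hy
  have := (PiLp.norm_apply_le y i).trans hy
  rw [norm_pow]
  exact pow_le_one₀ (norm_nonneg _) this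

theorem integral_coord_sq_uniformSphere (i : Fin d) :
    ∫ y, y i ^ 2 ∂(uniformSphere d) = 1 / d := by
  have hd : d ≠ 0 := by rintro rfl; exact i.elim0
  have same : ∀ j, ∫ y, y j ^ 2 ∂(uniformSphere d) = ∫ y, y i ^ 2 ∂(uniformSphere d) := fun j => by
    have := integral_comp_isometry_uniformSphere
      (LinearIsometryEquiv.piLpCongrLeft 2 ℝ ℝ (Equiv.swap i j))
      fun y : EuclideanSpace ℝ (Fin d) => y i ^ 2
    simp [LinearIsometryEquiv.piLpCongrLeft_apply, Equiv.piCongrLeft'] at this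
    exact this
  have sum : ∑ j, ∫ y, y j ^ 2 ∂(uniformSphere d) = 1 := by
    rw [← integral_finsetSum _ fun j _ => integrable_coord_sq_uniformSphere j]
    have : (fun y : EuclideanSpace ℝ (Fin d) => ∑ j, y j ^ 2) =ᵐ[uniformSphere d] fun _ => 1 := by
      filter_upwards [ae_norm_uniformSphere hd] with y hy
      rw [← EuclideanSpace.real_norm_sq_eq, hy, one_pow]
    rw [integral_congr_ae this]; simp
  rw [Finset.sum_congr rfl fun j _ => same j] at sum
  simp at sum
  have : (d : ℝ) ≠ 0 := by exact_mod_cast hd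
  field_simp; linarith

end sphere

/-! ### Information matrices of invariant designs -/

/-- A marginal design: a probability measure concentrated on `[-1, 1]`. -/
def IsMarginal (ξ : Measure ℝ) : Prop := IsProbabilityMeasure ξ ∧ ξ (Icc (-1) 1)ᶜ = 0

/-- The `q`-weighted moment `∫ q(t) tⁱ ξ(dt)`. -/
noncomputable def mom (q : ℝ → ℝ) (ξ : Measure ℝ) (i : ℕ) : ℝ := ∫ t, q t * t ^ i ∂ξ

theorem IsDesign.integrable {k : ℕ} {ξ : Measure (EuclideanSpace ℝ (Fin k))} (h : IsDesign ξ)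
    {f : EuclideanSpace ℝ (Fin k) → ℝ} (hf : Continuous f) : Integrable f ξ := by
  have := h.1
  have hr : ξ.restrict (Metric.closedBall 0 1) = ξ :=
    Measure.restrict_eq_self_of_ae_mem (mem_ae_iff.mpr h.2)
  rw [← hr]
  exact hf.continuousOn.integrableOn_compact (isCompact_closedBall 0 1)

theorem IsMarginal.integrable {ξ : Measure ℝ} (h : IsMarginal ξ) {f : ℝ → ℝ} (hf : Continuous f) :
    Integrable f ξ := by
  have := h.1
  have hr : ξ.restrict (Icc (-1) 1) = ξ :=
    Measure.restrict_eq_self_of_ae_mem (mem_ae_iff.mpr h.2)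
  rw [← hr]
  exact hf.continuousOn.integrableOn_compact isCompact_Icc

theorem continuous_orbitPoint {k : ℕ} :
    Continuous fun p : ℝ × EuclideanSpace ℝ (Fin (k - 1)) => orbitPoint (k := k) p.1 p.2 := by
  unfold orbitPoint
  refine (PiLp.continuous_toLp 2 _).comp (continuous_pi fun i => ?_)
  split_ifs
  · exact continuous_fst
  · fun_prop

theorem regressor_zero {n : ℕ} (x : EuclideanSpace ℝ (Fin (n + 1))) : regressor x 0 = 1 := rfl
theorem regressor_one {n : ℕ} (x : EuclideanSpace ℝ (Fin (n + 1))) : regressor x 1 = x 0 := rfl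
theorem regressor_succ_succ {n : ℕ} (x : EuclideanSpace ℝ (Fin (n + 1))) (i : Fin n) :
    regressor x i.succ.succ = x i.succ := rfl

theorem orbitPoint_zero {n : ℕ} (t : ℝ) (y : EuclideanSpace ℝ (Fin n)) :
    orbitPoint (k := n + 1) t y 0 = t := rfl
theorem orbitPoint_succ {n : ℕ} (t : ℝ) (y : EuclideanSpace ℝ (Fin n)) (i : Fin n) :
    orbitPoint (k := n + 1) t y i.succ = √(1 - t ^ 2) * y i := rfl

theorem norm_sq_eq_head_add {n : ℕ} (x : EuclideanSpace ℝ (Fin (n + 1))) :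
    ‖x‖ ^ 2 = x 0 ^ 2 + ∑ i : Fin n, x i.succ ^ 2 := by
  rw [EuclideanSpace.real_norm_sq_eq, Fin.sum_univ_succ]

theorem continuous_regressor {k : ℕ} (i : Fin (k + 1)) :
    Continuous fun x : EuclideanSpace ℝ (Fin k) => regressor x i := by
  refine Fin.cases continuous_const (fun j => ?_) i
  show Continuous fun x : EuclideanSpace ℝ (Fin k) => x j
  fun_prop

theorem IsMarginal.isDesign_invariantDesign {n : ℕ} {ξ : Measure ℝ} (h : IsMarginal ξ) :
    IsDesign (invariantDesign (n + 1) ξ) := by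
  have := h.1
  have hm := (continuous_orbitPoint (k := n + 1)).measurable
  refine ⟨Measure.isProbabilityMeasure_map hm.aemeasurable, ?_⟩
  rw [← mem_ae_iff, invariantDesign]
  refine (ae_map_iff (p := fun z => z ∈ Metric.closedBall (0 : EuclideanSpace ℝ (Fin (n + 1))) 1)
    hm.aemeasurable Metric.isClosed_closedBall.measurableSet).mpr ?_
  have h1 : ∀ᵐ p ∂(ξ.prod (uniformSphere (n + 1 - 1))), p.1 ∈ Icc (-1 : ℝ) 1 :=
    Measure.quasiMeasurePreserving_fst.ae (mem_ae_iff.mpr h.2)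
  have h2 : ∀ᵐ p ∂(ξ.prod (uniformSphere (n + 1 - 1))), ‖p.2‖ ≤ 1 :=
    Measure.quasiMeasurePreserving_snd.ae ae_norm_uniformSphere_le
  filter_upwards [h1, h2] with p hp1 hp2
  rw [mem_closedBall_zero_iff, ← abs_norm, ← sq_le_one_iff_abs_le_one, norm_sq_eq_head_add]
  have h0 : 0 ≤ 1 - p.1 ^ 2 := by nlinarith [hp1.1, hp1.2]
  have e : ∑ i : Fin n, orbitPoint (k := n + 1) p.1 p.2 i.succ ^ 2 = (1 - p.1 ^ 2) * ‖p.2‖ ^ 2 := by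
    rw [EuclideanSpace.real_norm_sq_eq, Finset.mul_sum]
    refine Finset.sum_congr rfl fun i _ => ?_
    rw [orbitPoint_succ, mul_pow, Real.sq_sqrt h0]
  rw [e, orbitPoint_zero]
  nlinarith [pow_le_one₀ (norm_nonneg p.2) hp2 (n := 2)]

theorem integral_invariantDesign_fst {n : ℕ} {ξ : Measure ℝ} (h : IsMarginal ξ) {f : ℝ → ℝ}
    (hf : Continuous f) : ∫ x, f (x 0) ∂(invariantDesign (n + 1) ξ) = ∫ t, f t ∂ξ := by
  have := h.1
  have hm := (continuous_orbitPoint (k := n + 1)).measurable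
  have hc : Continuous fun x : EuclideanSpace ℝ (Fin (n + 1)) => f (x 0) := by fun_prop
  rw [invariantDesign, integral_map hm.aemeasurable hc.aestronglyMeasurable]
  simp only [orbitPoint_zero]
  have h1 := integral_prod_mul (μ := ξ) (ν := uniformSphere n) f (fun _ => (1 : ℝ))
  simp only [mul_one, integral_const, probReal_univ, smul_eq_mul] at h1
  exact h1

/-- The indices of `f(x) = (1, x₁, x₂, …)`, split into the two that involve `x₁` only and the
others. -/
def splitEquiv (n : ℕ) : Fin 2 ⊕ Fin n ≃ Fin (n + 2) :=
  finSumFinEquiv.trans (finCongr (Nat.add_comm 2 n))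

theorem splitEquiv_inl_zero (n : ℕ) : splitEquiv n (.inl 0) = 0 := by
  ext; simp [splitEquiv]
theorem splitEquiv_inl_one (n : ℕ) : splitEquiv n (.inl 1) = 1 := by
  ext; simp [splitEquiv]
theorem splitEquiv_inr {n : ℕ} (i : Fin n) : splitEquiv n (.inr i) = i.succ.succ := by
  ext; simp [splitEquiv]

/-- The block diagonal matrix with blocks `(m₀ m₁; m₁ m₂)` and `s I`. -/
noncomputable def momentMatrix (n : ℕ) (m0 m1 m2 s : ℝ) : Matrix (Fin (n + 2)) (Fin (n + 2)) ℝ :=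
  (Matrix.fromBlocks !![m0, m1; m1, m2] 0 0 (Matrix.diagonal fun _ : Fin n => s)).submatrix
    (splitEquiv n).symm (splitEquiv n).symm

theorem momentMatrix_det (n : ℕ) (m0 m1 m2 s : ℝ) :
    (momentMatrix n m0 m1 m2 s).det = (m0 * m2 - m1 ^ 2) * s ^ n := by
  rw [momentMatrix, Matrix.det_submatrix_equiv_self, Matrix.det_fromBlocks_zero₂₁,
    Matrix.det_diagonal, Matrix.det_fin_two_of]
  simp; left; ring

theorem momentMatrix_inv {n : ℕ} {m0 m1 m2 s : ℝ} (hD : m0 * m2 - m1 ^ 2 ≠ 0)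
    (hs : 1 ≤ n → s ≠ 0) : (momentMatrix n m0 m1 m2 s)⁻¹ =
      momentMatrix n (m2 / (m0 * m2 - m1 ^ 2)) (-m1 / (m0 * m2 - m1 ^ 2))
        (m0 / (m0 * m2 - m1 ^ 2)) s⁻¹ := by
  refine Matrix.inv_eq_right_inv ?_
  rw [momentMatrix, momentMatrix, Matrix.submatrix_mul_equiv, Matrix.fromBlocks_multiply]
  have h1 : !![m0, m1; m1, m2] * !![m2 / (m0 * m2 - m1 ^ 2), -m1 / (m0 * m2 - m1 ^ 2);
      -m1 / (m0 * m2 - m1 ^ 2), m0 / (m0 * m2 - m1 ^ 2)] = 1 := by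
    rw [Matrix.mul_fin_two, Matrix.one_fin_two]
    congr! <;> field_simp <;> ring
  have h2 : (Matrix.diagonal fun _ : Fin n => s) * (Matrix.diagonal fun _ => s⁻¹) = 1 := by
    rw [Matrix.diagonal_mul_diagonal, ← Matrix.diagonal_one]
    congr 1; ext i
    exact mul_inv_cancel₀ (hs (by have := i.isLt; omega))
  simp [h1, h2]

section info

variable {n : ℕ} {lam q : ℝ → ℝ} {β : Fin (n + 1 + 1) → ℝ}

theorem linPredictor_eq (hβ : ∀ i : Fin (n + 1 + 1), 2 ≤ (i : ℕ) → β i = 0)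
    (x : EuclideanSpace ℝ (Fin (n + 1))) : linPredictor β x = β 0 + β 1 * x 0 := by
  rw [linPredictor, Fin.sum_univ_succ, Fin.sum_univ_succ, Finset.sum_eq_zero fun i _ => ?_]
  · rw [regressor_zero, show (Fin.succ 0 : Fin (n + 1 + 1)) = 1 from rfl, regressor_one]; ring
  · rw [hβ _ (by simp), mul_zero]

theorem elementalInfo_eq (hβ : ∀ i : Fin (n + 1 + 1), 2 ≤ (i : ℕ) → β i = 0)
    (hq : q = fun t => lam (β 0 + β 1 * t)) (x : EuclideanSpace ℝ (Fin (n + 1)))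
    (i j : Fin (n + 1 + 1)) :
    elementalInfo lam β x i j = q (x 0) * (regressor x i * regressor x j) := by
  rw [elementalInfo, linPredictor_eq hβ, hq]; simp [Matrix.vecMulVec_apply]

theorem infoMatrix_apply (hβ : ∀ i : Fin (n + 1 + 1), 2 ≤ (i : ℕ) → β i = 0)
    (hq : q = fun t => lam (β 0 + β 1 * t)) (ξ : Measure (EuclideanSpace ℝ (Fin (n + 1))))
    (i j : Fin (n + 1 + 1)) :
    infoMatrix lam β ξ i j = ∫ x, q (x 0) * (regressor x i * regressor x j) ∂ξ := by
  simp only [infoMatrix, Matrix.of_apply, elementalInfo_eq hβ hq]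

theorem continuous_info_entry (hqc : Continuous q) (i j : Fin (n + 1 + 1)) :
    Continuous fun x : EuclideanSpace ℝ (Fin (n + 1)) =>
      q (x 0) * (regressor x i * regressor x j) := by
  have := continuous_regressor (k := n + 1) i
  have := continuous_regressor (k := n + 1) j
  have : Continuous fun x : EuclideanSpace ℝ (Fin (n + 1)) => x 0 := by fun_prop
  fun_prop

theorem sum_mul_infoMatrix (hβ : ∀ i : Fin (n + 1 + 1), 2 ≤ (i : ℕ) → β i = 0)
    (hq : q = fun t => lam (β 0 + β 1 * t)) (hqc : Continuous q)
    {ξ : Measure (EuclideanSpace ℝ (Fin (n + 1)))} (hξ : IsDesign ξ)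
    (C : Fin (n + 1 + 1) → Fin (n + 1 + 1) → ℝ) :
    ∑ i, ∑ j, C i j * infoMatrix lam β ξ i j =
      ∫ x, q (x 0) * ∑ i, ∑ j, C i j * (regressor x i * regressor x j) ∂ξ := by
  simp only [infoMatrix_apply hβ hq, ← integral_const_mul, Finset.mul_sum]
  rw [integral_finsetSum]
  · refine Finset.sum_congr rfl fun i _ => ?_
    rw [integral_finsetSum]
    · refine Finset.sum_congr rfl fun j _ => integral_congr_ae (.of_forall fun x => ?_)
      simp only; ring
    · intro j _
      have := (hξ.integrable (continuous_info_entry hqc i j)).const_mul (C i j)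
      refine this.congr (.of_forall fun x => ?_)
      simp only; ring
  · intro i _
    refine integrable_finsetSum _ fun j _ => ?_
    have := (hξ.integrable (continuous_info_entry hqc i j)).const_mul (C i j)
    refine this.congr (.of_forall fun x => ?_)
    simp only; ring

theorem infoMatrix_posSemidef (hβ : ∀ i : Fin (n + 1 + 1), 2 ≤ (i : ℕ) → β i = 0)
    (hq : q = fun t => lam (β 0 + β 1 * t)) (hqc : Continuous q) (hq0 : ∀ t, 0 < q t)
    {ξ : Measure (EuclideanSpace ℝ (Fin (n + 1)))} (hξ : IsDesign ξ) :
    (infoMatrix lam β ξ).PosSemidef := by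
  refine Matrix.PosSemidef.of_dotProduct_mulVec_nonneg ?_ fun v => ?_
  · ext i j
    rw [Matrix.conjTranspose_apply, star_trivial, infoMatrix_apply hβ hq, infoMatrix_apply hβ hq]
    simp only [mul_comm (regressor _ i)]
  · have e : star v ⬝ᵥ (infoMatrix lam β ξ).mulVec v =
        ∑ i, ∑ j, (v i * v j) * infoMatrix lam β ξ i j := by
      simp only [dotProduct, Matrix.mulVec, Finset.mul_sum, Pi.star_apply, star_trivial]
      exact Finset.sum_congr rfl fun i _ => Finset.sum_congr rfl fun j _ => by ring
    rw [e, sum_mul_infoMatrix hβ hq hqc hξ]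
    refine integral_nonneg fun x => mul_nonneg (hq0 _).le ?_
    have : ∑ i, ∑ j, v i * v j * (regressor x i * regressor x j) =
        (∑ i, v i * regressor x i) ^ 2 := by
      rw [pow_two, Finset.sum_mul_sum]
      exact Finset.sum_congr rfl fun i _ => Finset.sum_congr rfl fun j _ => by ring
    rw [this]; positivity

/-- The mixed entries vanish and the diagonal entries agree because the uniform distribution on the
sphere in `ℝⁿ` has mean `0` and covariance matrix `I / n`. For `n = 0` the last block is empty. -/
theorem infoMatrix_invariantDesign (hβ : ∀ i : Fin (n + 1 + 1), 2 ≤ (i : ℕ) → β i = 0)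
    (hq : q = fun t => lam (β 0 + β 1 * t)) (hqc : Continuous q) {ξ : Measure ℝ}
    (hξ : IsMarginal ξ) :
    infoMatrix lam β (invariantDesign (n + 1) ξ) =
      momentMatrix n (mom q ξ 0) (mom q ξ 1) (mom q ξ 2) ((mom q ξ 0 - mom q ξ 2) / n) := by
  have := hξ.1
  have hm := (continuous_orbitPoint (k := n + 1)).measurable
  have key : ∀ i j, infoMatrix lam β (invariantDesign (n + 1) ξ) i j =
      ∫ p, q p.1 * (regressor (orbitPoint (k := n + 1) p.1 p.2) i *
        regressor (orbitPoint (k := n + 1) p.1 p.2) j) ∂(ξ.prod (uniformSphere n)) := by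
    intro i j
    rw [infoMatrix_apply hβ hq, invariantDesign, integral_map hm.aemeasurable
      (continuous_info_entry hqc i j).aestronglyMeasurable]
    rfl
  have prodE : ∀ (f : ℝ → ℝ) (g : EuclideanSpace ℝ (Fin n) → ℝ)
      (F : ℝ × EuclideanSpace ℝ (Fin n) → ℝ), (∀ p, F p = f p.1 * g p.2) →
      ∫ p, F p ∂(ξ.prod (uniformSphere n)) = (∫ t, f t ∂ξ) * ∫ y, g y ∂(uniformSphere n) := by
    intro f g F hF
    simp only [hF]
    exact integral_prod_mul f g
  have one : ∫ _, (1 : ℝ) ∂(uniformSphere n) = 1 := by simp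
  have main : (infoMatrix lam β (invariantDesign (n + 1) ξ)).submatrix (splitEquiv n)
      (splitEquiv n) = Matrix.fromBlocks !![mom q ξ 0, mom q ξ 1; mom q ξ 1, mom q ξ 2] 0 0
        (Matrix.diagonal fun _ : Fin n => (mom q ξ 0 - mom q ξ 2) / n) := by
    have mix : ∀ (f : ℝ → ℝ) (i : Fin n) (F : ℝ × EuclideanSpace ℝ (Fin n) → ℝ),
        (∀ p, F p = f p.1 * p.2 i) → ∫ p, F p ∂(ξ.prod (uniformSphere n)) = 0 := fun f i F hF => by
      rw [prodE f (fun y => y i) F hF, integral_coord_uniformSphere, mul_zero]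
    ext a b
    rw [Matrix.submatrix_apply, key]
    rcases a with a | i <;> rcases b with b | j
    · fin_cases a <;> fin_cases b
      all_goals simp only [Fin.zero_eta, Fin.mk_one, splitEquiv_inl_zero, splitEquiv_inl_one,
        regressor_zero, regressor_one, orbitPoint_zero, Matrix.fromBlocks_apply₁₁]
      · rw [prodE (fun t => q t * t ^ 0) (fun _ => 1) _ fun p => by simp, one]
        simp [mom]
      · rw [prodE (fun t => q t * t ^ 1) (fun _ => 1) _ fun p => by simp, one]
        simp [mom]
      · rw [prodE (fun t => q t * t ^ 1) (fun _ => 1) _ fun p => by simp, one]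
        simp [mom]
      · rw [prodE (fun t => q t * t ^ 2) (fun _ => 1) _ fun p => by ring, one]
        simp [mom]
    · rw [Matrix.fromBlocks_apply₁₂, Matrix.zero_apply]
      fin_cases a
      all_goals simp only [Fin.zero_eta, Fin.mk_one, splitEquiv_inl_zero, splitEquiv_inl_one,
        splitEquiv_inr, regressor_zero, regressor_one, regressor_succ_succ, orbitPoint_zero,
        orbitPoint_succ]
      · exact mix (fun t => q t * √(1 - t ^ 2)) j _ fun p => by ring
      · exact mix (fun t => q t * t * √(1 - t ^ 2)) j _ fun p => by ring
    · rw [Matrix.fromBlocks_apply₂₁, Matrix.zero_apply]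
      fin_cases b
      all_goals simp only [Fin.zero_eta, Fin.mk_one, splitEquiv_inl_zero, splitEquiv_inl_one,
        splitEquiv_inr, regressor_zero, regressor_one, regressor_succ_succ, orbitPoint_zero,
        orbitPoint_succ]
      · exact mix (fun t => q t * √(1 - t ^ 2)) i _ fun p => by ring
      · exact mix (fun t => q t * t * √(1 - t ^ 2)) i _ fun p => by ring
    · simp only [Matrix.fromBlocks_apply₂₂, splitEquiv_inr, regressor_succ_succ,
        orbitPoint_succ]
      rw [prodE (fun t => q t * (√(1 - t ^ 2) * √(1 - t ^ 2))) (fun y => y i * y j) _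
        fun p => by ring]
      rcases eq_or_ne i j with rfl | hij
      · rw [Matrix.diagonal_apply_eq]
        simp only [← pow_two, integral_coord_sq_uniformSphere]
        have : ∫ t, q t * √(1 - t ^ 2) ^ 2 ∂ξ = mom q ξ 0 - mom q ξ 2 := by
          rw [mom, mom, ← integral_sub (hξ.integrable (by fun_prop)) (hξ.integrable (by fun_prop))]
          refine integral_congr_ae ?_
          filter_upwards [mem_ae_iff.mpr hξ.2] with t ht
          rw [Real.sq_sqrt (by nlinarith [ht.1, ht.2])]; ring
        rw [this]; ring
      · rw [Matrix.diagonal_apply_ne _ hij, integral_coord_mul_coord_uniformSphere hij, mul_zero]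
  rw [momentMatrix, ← main, Matrix.submatrix_submatrix]
  simp

end info

/-! ### The equivalence theorem -/

/-- The sensitivity `f(x)ᵀ M⁻¹ f(x)` of an invariant design with moments `m₀, m₁, m₂`, without the
factor `λ`; on the unit sphere it depends on `t = x₁` only. -/
noncomputable def sens (n : ℕ) (m0 m1 m2 t : ℝ) : ℝ :=
  (m2 - 2 * m1 * t + m0 * t ^ 2) / (m0 * m2 - m1 ^ 2) + n * (1 - t ^ 2) / (m0 - m2)

section equivalence

variable {n : ℕ} {lam q : ℝ → ℝ} {β : Fin (n + 1 + 1) → ℝ}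

theorem continuous_sens (n : ℕ) (m0 m1 m2 : ℝ) : Continuous (sens n m0 m1 m2) := by
  unfold sens
  simp only [div_eq_mul_inv]
  fun_prop

/-- The quadratic form of `momentMatrix`. -/
theorem sum_momentMatrix (m0 m1 m2 s : ℝ) (v : Fin (n + 1 + 1) → ℝ) :
    ∑ i, ∑ j, momentMatrix n m0 m1 m2 s i j * (v i * v j) =
      m0 * v 0 ^ 2 + 2 * m1 * (v 0 * v 1) + m2 * v 1 ^ 2 + s * ∑ i : Fin n, v i.succ.succ ^ 2 := by
  rw [← (splitEquiv n).sum_comp]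
  simp_rw [← (splitEquiv n).sum_comp (fun j => momentMatrix n m0 m1 m2 s _ j * (_ * v j))]
  simp only [Fintype.sum_sum_type, Fin.sum_univ_two, momentMatrix, Matrix.submatrix_apply,
    Equiv.symm_apply_apply, Matrix.fromBlocks_apply₁₁, Matrix.fromBlocks_apply₁₂,
    Matrix.fromBlocks_apply₂₁, Matrix.fromBlocks_apply₂₂, Matrix.diagonal_apply,
    splitEquiv_inl_zero, splitEquiv_inl_one, splitEquiv_inr, Matrix.zero_apply]
  simp [Finset.mul_sum]
  ring_nf

theorem IsMarginal.det_infoMatrix (hβ : ∀ i : Fin (n + 1 + 1), 2 ≤ (i : ℕ) → β i = 0)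
    (hq : q = fun t => lam (β 0 + β 1 * t)) (hqc : Continuous q) {ξ : Measure ℝ}
    (hξ : IsMarginal ξ) :
    (infoMatrix lam β (invariantDesign (n + 1) ξ)).det =
      (mom q ξ 0 * mom q ξ 2 - mom q ξ 1 ^ 2) * ((mom q ξ 0 - mom q ξ 2) / n) ^ n := by
  rw [infoMatrix_invariantDesign hβ hq hqc hξ, momentMatrix_det]

theorem IsMarginal.mom_sub_nonneg (hqc : Continuous q) (hq0 : ∀ t, 0 < q t) {ξ : Measure ℝ}
    (hξ : IsMarginal ξ) : 0 ≤ mom q ξ 0 - mom q ξ 2 := by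
  rw [mom, mom, ← integral_sub (hξ.integrable (by fun_prop)) (hξ.integrable (by fun_prop))]
  refine integral_nonneg_of_ae ?_
  filter_upwards [mem_ae_iff.mpr hξ.2] with t ht
  have : 0 ≤ 1 - t ^ 2 := by nlinarith [ht.1, ht.2]
  have := mul_nonneg (hq0 t).le this
  simp only [Pi.zero_apply]; linarith

/-- The sensitivity of a regular invariant design bounds the determinant at any other design `ξ'`.
With `B` and `A` the information matrices of the two, `tr (B⁻¹ A)` is the integral of `λ fᵀ B⁻¹ f`
against `ξ'`, and inside the ball `fᵀ B⁻¹ f` is at most its value `sens` on the sphere with the same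
`x₁`. -/
theorem IsMarginal.det_le (hβ : ∀ i : Fin (n + 1 + 1), 2 ≤ (i : ℕ) → β i = 0)
    (hq : q = fun t => lam (β 0 + β 1 * t)) (hqc : Continuous q) (hq0 : ∀ t, 0 < q t)
    {ξ : Measure ℝ} (hξ : IsMarginal ξ) (hD : mom q ξ 0 * mom q ξ 2 - mom q ξ 1 ^ 2 ≠ 0)
    (hv : 1 ≤ n → mom q ξ 0 - mom q ξ 2 ≠ 0)
    {ξ' : Measure (EuclideanSpace ℝ (Fin (n + 1)))} (hξ' : IsDesign ξ') :
    (infoMatrix lam β ξ').det ≤ (infoMatrix lam β (invariantDesign (n + 1) ξ)).det *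
      Real.exp (∫ x, q (x 0) * sens n (mom q ξ 0) (mom q ξ 1) (mom q ξ 2) (x 0) ∂ξ' - (n + 2)) := by
  set m0 := mom q ξ 0
  set m1 := mom q ξ 1
  set m2 := mom q ξ 2
  have := hξ'.1
  have hs : 1 ≤ n → (m0 - m2) / n ≠ 0 := fun hn =>
    div_ne_zero (hv hn) (by exact_mod_cast (by omega : n ≠ 0))
  have hA := infoMatrix_posSemidef hβ hq hqc hq0 hξ'
  have hB := infoMatrix_posSemidef hβ hq hqc hq0 hξ.isDesign_invariantDesign
  have hdet := hξ.det_infoMatrix hβ hq hqc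
  have hdet0 : (infoMatrix lam β (invariantDesign (n + 1) ξ)).det ≠ 0 := by
    rw [hdet]
    refine mul_ne_zero hD ?_
    rcases Nat.eq_zero_or_pos n with h | h
    · subst h; simp
    · exact pow_ne_zero _ (hs h)
  have hBpos : (infoMatrix lam β (invariantDesign (n + 1) ξ)).PosDef :=
    hB.posDef_iff_isUnit.mpr ((Matrix.isUnit_iff_isUnit_det _).mpr hdet0.isUnit)
  refine (hA.det_le_det_mul_exp hBpos).trans
    (mul_le_mul_of_nonneg_left (Real.exp_le_exp.mpr ?_) hBpos.det_pos.le)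
  rw [infoMatrix_invariantDesign hβ hq hqc hξ, momentMatrix_inv hD hs]
  have card : (Fintype.card (Fin (n + 1 + 1)) : ℝ) = n + 2 := by simp; ring
  rw [card]
  refine sub_le_sub_right ?_ _
  set C := momentMatrix n (m2 / (m0 * m2 - m1 ^ 2)) (-m1 / (m0 * m2 - m1 ^ 2))
    (m0 / (m0 * m2 - m1 ^ 2)) ((m0 - m2) / n)⁻¹ with hC
  have htr : (C * infoMatrix lam β ξ').trace = ∑ i, ∑ j, C i j * infoMatrix lam β ξ' i j := by
    simp only [Matrix.trace, Matrix.diag_apply, Matrix.mul_apply]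
    refine Finset.sum_congr rfl fun i _ => Finset.sum_congr rfl fun j _ => ?_
    congr 1
    have := congrFun (congrFun hA.1 i) j
    rwa [Matrix.conjTranspose_apply, star_trivial] at this
  refine (htr.trans (sum_mul_infoMatrix hβ hq hqc hξ' fun i j => C i j)).trans_le ?_
  have c0 : Continuous fun x : EuclideanSpace ℝ (Fin (n + 1)) => x 0 := by fun_prop
  refine integral_mono_ae (hξ'.integrable ?_) (hξ'.integrable ?_) ?_
  · have := continuous_regressor (k := n + 1)
    fun_prop
  · exact (hqc.comp c0).mul ((continuous_sens n m0 m1 m2).comp c0)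
  filter_upwards [mem_ae_iff.mpr hξ'.2] with x hx
  refine mul_le_mul_of_nonneg_left ?_ (hq0 _).le
  rw [hC, sum_momentMatrix, regressor_zero, regressor_one]
  simp only [regressor_succ_succ]
  have hx1 : ∑ i : Fin n, x i.succ ^ 2 ≤ 1 - x 0 ^ 2 := by
    rw [mem_closedBall_zero_iff] at hx
    have := pow_le_one₀ (norm_nonneg x) hx (n := 2)
    rw [norm_sq_eq_head_add] at this
    linarith
  have hs0 : 0 ≤ ((m0 - m2) / n)⁻¹ :=
    inv_nonneg.mpr (div_nonneg (hξ.mom_sub_nonneg hqc hq0) n.cast_nonneg)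
  have h2 := mul_le_mul_of_nonneg_left hx1 hs0
  have e : sens n m0 m1 m2 (x 0) = m2 / (m0 * m2 - m1 ^ 2) * 1 ^ 2 +
      2 * (-m1 / (m0 * m2 - m1 ^ 2)) * (1 * x 0) + m0 / (m0 * m2 - m1 ^ 2) * x 0 ^ 2 +
      ((m0 - m2) / n)⁻¹ * (1 - x 0 ^ 2) := by
    rw [sens, inv_div]; ring
  rw [e]
  linarith

/-- The sufficient half of the equivalence theorem. -/
theorem IsMarginal.isLocallyDOptimal_of_sens_le
    (hβ : ∀ i : Fin (n + 1 + 1), 2 ≤ (i : ℕ) → β i = 0)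
    (hq : q = fun t => lam (β 0 + β 1 * t)) (hqc : Continuous q) (hq0 : ∀ t, 0 < q t)
    {ξ : Measure ℝ} (hξ : IsMarginal ξ) (hD : mom q ξ 0 * mom q ξ 2 - mom q ξ 1 ^ 2 ≠ 0)
    (hv : 1 ≤ n → mom q ξ 0 - mom q ξ 2 ≠ 0)
    (hs : ∀ t ∈ Icc (-1 : ℝ) 1, q t * sens n (mom q ξ 0) (mom q ξ 1) (mom q ξ 2) t ≤ n + 2) :
    IsLocallyDOptimalMarginal lam β ξ := by
  have hdet0 : (infoMatrix lam β (invariantDesign (n + 1) ξ)).det ≠ 0 := by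
    rw [hξ.det_infoMatrix hβ hq hqc]
    refine mul_ne_zero hD ?_
    rcases Nat.eq_zero_or_pos n with h | h
    · subst h; simp
    · exact pow_ne_zero _ (div_ne_zero (hv h) (by exact_mod_cast h.ne'))
  have hB := infoMatrix_posSemidef hβ hq hqc hq0 hξ.isDesign_invariantDesign
  refine ⟨hξ.1, hξ.2, hξ.isDesign_invariantDesign,
    (Matrix.isUnit_iff_isUnit_det _).mpr hdet0.isUnit, fun ξ' hξ' => ?_⟩
  have := hξ'.1
  refine (hξ.det_le hβ hq hqc hq0 hD hv hξ').trans (mul_le_of_le_one_right hB.det_nonneg ?_)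
  rw [Real.exp_le_one_iff, sub_nonpos]
  have c0 : Continuous fun x : EuclideanSpace ℝ (Fin (n + 1)) => x 0 := by fun_prop
  have : ∫ x, q (x 0) * sens n (mom q ξ 0) (mom q ξ 1) (mom q ξ 2) (x 0) ∂ξ' ≤
      ∫ _, ((n : ℝ) + 2) ∂ξ' := by
    refine integral_mono_ae (hξ'.integrable
      ((hqc.comp c0).mul ((continuous_sens n _ _ _).comp c0))) (integrable_const _) ?_
    filter_upwards [mem_ae_iff.mpr hξ'.2] with x hx
    refine hs _ (abs_le.mp ?_)
    have h1 := PiLp.norm_apply_le x 0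
    rw [mem_closedBall_zero_iff] at hx
    exact h1.trans hx
  simpa using this

/-- At a maximizer of the determinant among marginal designs, moving towards a point mass does not
increase it; this is the necessary half of the equivalence theorem. -/
theorem IsMarginal.sens_le_of_isMax (hqc : Continuous q) {ξ : Measure ℝ} (hξ : IsMarginal ξ)
    (hD : 0 < mom q ξ 0 * mom q ξ 2 - mom q ξ 1 ^ 2)
    (hv : 1 ≤ n → 0 < mom q ξ 0 - mom q ξ 2)
    (hmax : ∀ ξ', IsMarginal ξ' →
      (mom q ξ' 0 * mom q ξ' 2 - mom q ξ' 1 ^ 2) * (mom q ξ' 0 - mom q ξ' 2) ^ n ≤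
      (mom q ξ 0 * mom q ξ 2 - mom q ξ 1 ^ 2) * (mom q ξ 0 - mom q ξ 2) ^ n)
    {t : ℝ} (ht : t ∈ Icc (-1 : ℝ) 1) :
    q t * sens n (mom q ξ 0) (mom q ξ 1) (mom q ξ 2) t ≤ n + 2 := by
  have := hξ.1
  set m0 := mom q ξ 0 with hm0
  set m1 := mom q ξ 1 with hm1
  set m2 := mom q ξ 2 with hm2
  have hmix : ∀ ε ∈ Icc (0 : ℝ) 1, ∃ ξ', IsMarginal ξ' ∧
      ∀ i, mom q ξ' i = mom q ξ i + ε * (q t * t ^ i - mom q ξ i) := fun ε hε => by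
    have h1 : 0 ≤ 1 - ε := sub_nonneg.mpr hε.2
    refine ⟨ENNReal.ofReal (1 - ε) • ξ + ENNReal.ofReal ε • Measure.dirac t, ⟨⟨?_⟩, ?_⟩,
      fun i => ?_⟩
    · simp [← ENNReal.ofReal_add h1 hε.1]
    · have : t ∉ (Icc (-1 : ℝ) 1)ᶜ := fun h => h ht
      simp [hξ.2, this, -mem_compl_iff, -mem_Icc]
    · have hi : Integrable (fun s => q s * s ^ i) ξ := hξ.integrable (by fun_prop)
      rw [mom, integral_add_measure (hi.smul_measure (by simp))
        ((integrable_dirac enorm_lt_top).smul_measure (by simp)), integral_smul_measure,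
        integral_smul_measure, integral_dirac, ENNReal.toReal_ofReal h1,
        ENNReal.toReal_ofReal hε.1, ← mom]
      simp only [smul_eq_mul]; ring
  set d0 := q t - m0 with hd0
  set d1 := q t * t - m1 with hd1
  set d2 := q t * t ^ 2 - m2 with hd2
  set G : ℝ → ℝ := fun ε => ((m0 + ε * d0) * (m2 + ε * d2) - (m1 + ε * d1) ^ 2) *
    ((m0 + ε * d0) - (m2 + ε * d2)) ^ n with hG
  have hder : HasDerivAt G ((d0 * m2 + m0 * d2 - 2 * m1 * d1) * (m0 - m2) ^ n +
      (m0 * m2 - m1 ^ 2) * (n * (m0 - m2) ^ (n - 1) * (d0 - d2))) 0 := by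
    have l : ∀ a b : ℝ, HasDerivAt (fun ε : ℝ => a + ε * b) b 0 := fun a b => by
      simpa using ((hasDerivAt_id (0 : ℝ)).mul_const b).const_add a
    refine ((((l m0 d0).mul (l m2 d2)).sub ((l m1 d1).pow 2)).mul
      (((l m0 d0).sub (l m2 d2)).pow n)).congr_deriv ?_
    simp
  have hle : ∀ ε ∈ Icc (0 : ℝ) 1, -G 0 ≤ -G ε := fun ε hε => by
    obtain ⟨ξ', hξ', hm⟩ := hmix ε hε
    have := hmax ξ' hξ'
    rw [hm, hm, hm] at this
    simp only [pow_zero, mul_one, pow_one] at this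
    simp only [hG, zero_mul, add_zero, neg_le_neg_iff]
    exact this
  have h0 := hder.neg.nonneg_of_forall_le_right one_pos hle
  have h1 : (d0 * m2 + m0 * d2 - 2 * m1 * d1) / (m0 * m2 - m1 ^ 2) +
      n * (d0 - d2) / (m0 - m2) ≤ 0 := by
    rcases Nat.eq_zero_or_pos n with hn | hn
    · subst hn
      simp at h0 ⊢
      exact div_nonpos_of_nonpos_of_nonneg (by linarith) hD.le
    · have hv' := hv hn
      rw [div_add_div _ _ hD.ne' hv'.ne']
      refine div_nonpos_of_nonpos_of_nonneg ?_ (by positivity)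
      obtain ⟨l, rfl⟩ : ∃ l, n = l + 1 := ⟨n - 1, by omega⟩
      rw [Nat.add_sub_cancel, pow_succ] at h0
      have h2 : (m0 - m2) ^ l * ((d0 * m2 + m0 * d2 - 2 * m1 * d1) * (m0 - m2) +
        (m0 * m2 - m1 ^ 2) * ((l + 1 : ℕ) * (d0 - d2))) ≤ 0 := by linarith
      have h3 : 0 < (m0 - m2) ^ l := by positivity
      exact nonpos_of_mul_nonpos_right h2 h3
  have h2 : q t * sens n m0 m1 m2 t = (d0 * m2 + m0 * d2 - 2 * m1 * d1) / (m0 * m2 - m1 ^ 2) +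
      n * (d0 - d2) / (m0 - m2) + (2 + n * ((m0 - m2) / (m0 - m2))) := by
    have h3 : (d0 * m2 + m0 * d2 - 2 * m1 * d1) / (m0 * m2 - m1 ^ 2) =
        q t * ((m2 - 2 * m1 * t + m0 * t ^ 2) / (m0 * m2 - m1 ^ 2)) - 2 := by
      have hD' := hD.ne'
      rw [hd0, hd1, hd2]; field_simp; ring
    rw [sens, h3]; ring
  have h3 : (n : ℝ) * ((m0 - m2) / (m0 - m2)) = n := by
    rcases Nat.eq_zero_or_pos n with hn | hn
    · subst hn; simp
    · rw [div_self (hv hn).ne', mul_one]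
  rw [h2, h3]; linarith

end equivalence

/-! ### Existence, two-point support and uniqueness -/

/-- The two-point probability measure with weight `α` at `x` and `1 - α` at `y`. -/
noncomputable def pairMeasure (x y α : ℝ) : Measure ℝ :=
  ENNReal.ofReal α • Measure.dirac x + ENNReal.ofReal (1 - α) • Measure.dirac y

section pairMeasure

variable {x y α : ℝ}

theorem isMarginal_pairMeasure (hα : α ∈ Icc (0 : ℝ) 1) (hx : x ∈ Icc (-1 : ℝ) 1)
    (hy : y ∈ Icc (-1 : ℝ) 1) : IsMarginal (pairMeasure x y α) := by
  refine ⟨⟨?_⟩, ?_⟩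
  · simp [pairMeasure, ← ENNReal.ofReal_add hα.1 (sub_nonneg.mpr hα.2)]
  · have h1 : x ∉ (Icc (-1 : ℝ) 1)ᶜ := fun h => h hx
    have h2 : y ∉ (Icc (-1 : ℝ) 1)ᶜ := fun h => h hy
    simp [pairMeasure, h1, h2, -mem_compl_iff, -mem_Icc]

theorem integral_pairMeasure (hα : α ∈ Icc (0 : ℝ) 1) (f : ℝ → ℝ) :
    ∫ t, f t ∂(pairMeasure x y α) = α * f x + (1 - α) * f y := by
  have h (a : ℝ) : Integrable f (Measure.dirac a) := integrable_dirac enorm_lt_top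
  rw [pairMeasure, integral_add_measure ((h x).smul_measure (by simp))
    ((h y).smul_measure (by simp)), integral_smul_measure, integral_smul_measure, integral_dirac,
    integral_dirac, ENNReal.toReal_ofReal hα.1, ENNReal.toReal_ofReal (sub_nonneg.mpr hα.2)]
  rfl

theorem pairMeasure_real_left (hα : α ∈ Icc (0 : ℝ) 1) (hxy : y ≠ x) :
    (pairMeasure x y α).real {x} = α := by
  simp [pairMeasure, Measure.real, hxy, hα.1]

theorem pairMeasure_real_right (hα : α ∈ Icc (0 : ℝ) 1) (hxy : y ≠ x) :
    (pairMeasure x y α).real {y} = 1 - α := by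
  simp [pairMeasure, Measure.real, hxy.symm, hα.2]

theorem support_pairMeasure (hα : α ∈ Ioo (0 : ℝ) 1) : (pairMeasure x y α).support = {x, y} := by
  have h1 : 0 < 1 - α := sub_pos.mpr hα.2
  ext z
  rw [Measure.mem_support_iff_forall]
  constructor
  · intro h
    by_contra hz
    have := h {x, y}ᶜ ((Set.toFinite {x, y}).isClosed.isOpen_compl.mem_nhds hz)
    simp [pairMeasure] at this
  · rintro (rfl | rfl) U hU
    · have : z ∈ U := mem_of_mem_nhds hU
      simp [pairMeasure, this, hα.1]
    · have : z ∈ U := mem_of_mem_nhds hU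
      simp [pairMeasure, this, hα.2]

theorem eq_pairMeasure {ξ : Measure ℝ} [IsProbabilityMeasure ξ] (hxy : y ≠ x)
    (h : ξ {x, y}ᶜ = 0) : ξ = pairMeasure x y (ξ.real {x}) := by
  have hr : ξ.restrict {x, y} = ξ := Measure.restrict_eq_self_of_ae_mem (mem_ae_iff.mpr h)
  have hd : Disjoint ({x} : Set ℝ) {y} := disjoint_singleton.mpr hxy.symm
  have h1 : ξ.real {x} + ξ.real {y} = 1 := by
    rw [← measureReal_union hd (measurableSet_singleton y), ← insert_eq]
    have := measureReal_compl (μ := ξ) (s := {x, y}) (Set.toFinite _).measurableSet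
    rw [measureReal_def, h] at this
    simp at this; linarith
  conv_lhs => rw [← hr, insert_eq, Measure.restrict_union hd (measurableSet_singleton y),
    Measure.restrict_singleton, Measure.restrict_singleton]
  rw [pairMeasure, ← h1, add_sub_cancel_left, ofReal_measureReal, ofReal_measureReal]

end pairMeasure

section pair

variable {n : ℕ} {lam q U1 U2 : ℝ → ℝ} {c x y α : ℝ}

theorem mom_pairMeasure (hα : α ∈ Icc (0 : ℝ) 1) (i : ℕ) :
    mom q (pairMeasure x y α) i = α * (q x * x ^ i) + (1 - α) * (q y * y ^ i) :=
  integral_pairMeasure hα _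

theorem mom_det_pairMeasure (hα : α ∈ Icc (0 : ℝ) 1) :
    mom q (pairMeasure x y α) 0 * mom q (pairMeasure x y α) 2 - mom q (pairMeasure x y α) 1 ^ 2 =
      α * (1 - α) * q x * q y * (x - y) ^ 2 := by
  simp only [mom_pairMeasure hα]; ring

theorem mom_sub_pairMeasure (hα : α ∈ Icc (0 : ℝ) 1) :
    mom q (pairMeasure x y α) 0 - mom q (pairMeasure x y α) 2 = pairB q x y α := by
  simp only [mom_pairMeasure hα, pairB]; ring

theorem sens_pairMeasure (hq : ∀ t, 0 < q t) (hα : α ∈ Ioo (0 : ℝ) 1) (hyx : y < x) (t : ℝ) :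
    sens n (mom q (pairMeasure x y α) 0) (mom q (pairMeasure x y α) 1)
      (mom q (pairMeasure x y α) 2) t = pairSens n q x y α t := by
  have hα' := Ioo_subset_Icc_self hα
  rw [sens, mom_det_pairMeasure hα', mom_sub_pairMeasure hα', pairSens]
  simp only [mom_pairMeasure hα']
  congr 1
  have h1 := hα.1
  have h2 := sub_pos.mpr hα.2
  have h3 := sub_pos.mpr hyx
  have h4 := hq x
  have h5 := hq y
  field_simp
  ring

/-- The derivative of the gap between `1 / q` and the normalized sensitivity. -/
theorem hasDerivAt_sensGap (H : IsRecipIntensity (fun t => 1 / q t) U1 U2 c) (m0 m1 m2 t : ℝ) :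
    HasDerivAt (fun t => 1 / q t - sens n m0 m1 m2 t / (n + 2))
      (U1 t - ((-2 * m1 + 2 * m0 * t) / (m0 * m2 - m1 ^ 2) - 2 * n * t / (m0 - m2)) / (n + 2))
      t := by
  have i := hasDerivAt_id t
  have e1 := (((i.const_mul (2 * m1)).const_sub m2).add ((i.pow 2).const_mul m0)).div_const
    (m0 * m2 - m1 ^ 2)
  have e2 := (((i.pow 2).const_sub 1).const_mul (n : ℝ)).div_const (m0 - m2)
  refine ((H.d1 t).sub ((e1.add e2).div_const ((n : ℝ) + 2))).congr_deriv ?_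
  simp only [id]; ring

theorem hasDerivAt_sensGapDeriv (H : IsRecipIntensity (fun t => 1 / q t) U1 U2 c)
    (m0 m1 m2 t : ℝ) :
    HasDerivAt (fun t => U1 t - ((-2 * m1 + 2 * m0 * t) / (m0 * m2 - m1 ^ 2) -
        2 * n * t / (m0 - m2)) / (n + 2))
      (U2 t - (2 * m0 / (m0 * m2 - m1 ^ 2) - 2 * n / (m0 - m2)) / (n + 2)) t := by
  have i := hasDerivAt_id t
  have e1 := ((i.const_mul (2 * m0)).const_add (-2 * m1)).div_const (m0 * m2 - m1 ^ 2)
  have e2 := (i.const_mul (2 * n : ℝ)).div_const (m0 - m2)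
  refine ((H.d2 t).sub ((e1.sub e2).div_const ((n : ℝ) + 2))).congr_deriv ?_
  ring

/-- The pair is allowed to be larger than `S`, so that no case distinction on the size of `S` is
needed later. -/
theorem exists_pair_of_not_three {S : Set ℝ} (hS : S ⊆ Icc (-1) 1)
    (h3 : ∀ a ∈ S, ∀ b ∈ S, ∀ d ∈ S, a < b → b < d → False) :
    ∃ x y, -1 ≤ y ∧ y < x ∧ x ≤ 1 ∧ S ⊆ {x, y} := by
  by_cases hsub : S.Subsingleton
  · rcases S.eq_empty_or_nonempty with rfl | ⟨a, ha⟩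
    · exact ⟨1, -1, le_rfl, by norm_num, le_rfl, empty_subset _⟩
    · have hs : S ⊆ {a} := fun b hb => hsub hb ha
      rcases (hS ha).2.lt_or_eq with h | h
      · exact ⟨1, a, (hS ha).1, h, le_rfl, hs.trans (by simp)⟩
      · exact ⟨a, -1, le_rfl, by linarith, h.le, hs.trans (by simp)⟩
  · obtain ⟨a, ha, b, hb, hab⟩ := not_subsingleton_iff.mp hsub
    wlog hlt : a < b generalizing a b
    · exact this b hb a ha hab.symm (lt_of_le_of_ne (not_lt.mp hlt) hab.symm)
    refine ⟨b, a, (hS ha).1, hlt, (hS hb).2, fun d hd => ?_⟩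
    by_contra hne
    simp only [mem_insert_iff, mem_singleton_iff, not_or] at hne
    rcases lt_or_gt_of_ne hne.2 with h | h
    · exact h3 d hd a ha b hb h hlt
    · rcases lt_or_gt_of_ne hne.1 with h' | h'
      · exact h3 a ha d hd b hb h h'
      · exact h3 a ha b hb d hd hlt h'

/-- The points of `[-1, 1]` at which the sensitivity bound holds with equality. -/
def contactSet (n : ℕ) (q : ℝ → ℝ) (ξ : Measure ℝ) : Set ℝ :=
  {t ∈ Icc (-1) 1 | q t * sens n (mom q ξ 0) (mom q ξ 1) (mom q ξ 2) t = n + 2}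

theorem exists_contactSet_subset_pair (H : IsRecipIntensity (fun t => 1 / q t) U1 U2 c)
    {ξ : Measure ℝ}
    (hs : ∀ t ∈ Icc (-1 : ℝ) 1, q t * sens n (mom q ξ 0) (mom q ξ 1) (mom q ξ 2) t ≤ n + 2) :
    ∃ x y, -1 ≤ y ∧ y < x ∧ x ≤ 1 ∧ contactSet n q ξ ⊆ {x, y} := by
  refine exists_pair_of_not_three (fun t ht => ht.1) fun a ha b hb d hd hab hbd => ?_
  have hn : (0 : ℝ) < n + 2 := by positivity
  have zero : ∀ t ∈ contactSet n q ξ,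
      1 / q t - sens n (mom q ξ 0) (mom q ξ 1) (mom q ξ 2) t / (n + 2) = 0 := fun t ht => by
    have := H.q_pos t
    have e := ht.2
    field_simp; linarith
  refine H.not_three_zeros (hasDerivAt_sensGap (n := n) H _ _ _)
    (hasDerivAt_sensGapDeriv H _ _ _) (fun t ht => ?_) ha.1.1 hab hbd hd.1.2 (zero a ha)
    (zero b hb) (zero d hd)
  have := H.q_pos t
  rw [sub_nonneg, div_le_div_iff₀ hn this]
  linarith [hs t ht]

end pair

section optimal

variable {n : ℕ} {lam q U1 U2 : ℝ → ℝ} {β : Fin (n + 1 + 1) → ℝ} {c x y α : ℝ} {ξ ξ' : Measure ℝ}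

theorem IsLocallyDOptimalMarginal.isMarginal (h : IsLocallyDOptimalMarginal lam β ξ) :
    IsMarginal ξ := ⟨h.1, h.2.1⟩

theorem IsLocallyDOptimalMarginal.mom_sub_ne_zero
    (hβ : ∀ i : Fin (n + 1 + 1), 2 ≤ (i : ℕ) → β i = 0)
    (hq : q = fun t => lam (β 0 + β 1 * t)) (hqc : Continuous q)
    (h : IsLocallyDOptimalMarginal lam β ξ) (hn : 1 ≤ n) : mom q ξ 0 - mom q ξ 2 ≠ 0 := by
  have hdet := ((Matrix.isUnit_iff_isUnit_det _).mp h.2.2.2.1).ne_zero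
  rw [h.isMarginal.det_infoMatrix hβ hq hqc] at hdet
  intro h0
  rw [h0, zero_div, zero_pow (by omega), mul_zero] at hdet
  exact hdet rfl

theorem IsLocallyDOptimalMarginal.mom_det_pos
    (hβ : ∀ i : Fin (n + 1 + 1), 2 ≤ (i : ℕ) → β i = 0)
    (hq : q = fun t => lam (β 0 + β 1 * t)) (hqc : Continuous q) (hq0 : ∀ t, 0 < q t)
    (h : IsLocallyDOptimalMarginal lam β ξ) : 0 < mom q ξ 0 * mom q ξ 2 - mom q ξ 1 ^ 2 := by
  have hdet := ((Matrix.isUnit_iff_isUnit_det _).mp h.2.2.2.1).ne_zero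
  have h1 := (infoMatrix_posSemidef hβ hq hqc hq0 h.2.2.1).det_nonneg.lt_of_ne hdet.symm
  rw [h.isMarginal.det_infoMatrix hβ hq hqc] at h1
  exact pos_of_mul_pos_left h1 (pow_nonneg (div_nonneg (h.isMarginal.mom_sub_nonneg hqc hq0)
    n.cast_nonneg) _)

theorem IsLocallyDOptimalMarginal.sens_le
    (hβ : ∀ i : Fin (n + 1 + 1), 2 ≤ (i : ℕ) → β i = 0)
    (hq : q = fun t => lam (β 0 + β 1 * t)) (hqc : Continuous q) (hq0 : ∀ t, 0 < q t)
    (h : IsLocallyDOptimalMarginal lam β ξ) :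
    ∀ t ∈ Icc (-1 : ℝ) 1, q t * sens n (mom q ξ 0) (mom q ξ 1) (mom q ξ 2) t ≤ n + 2 := by
  intro t ht
  refine h.isMarginal.sens_le_of_isMax hqc (h.mom_det_pos hβ hq hqc hq0)
    (fun hn => (h.isMarginal.mom_sub_nonneg hqc hq0).lt_of_ne
      (h.mom_sub_ne_zero hβ hq hqc hn).symm) (fun ξ' hξ' => ?_) ht
  have := h.2.2.2.2 _ hξ'.isDesign_invariantDesign
  rw [h.isMarginal.det_infoMatrix hβ hq hqc, hξ'.det_infoMatrix hβ hq hqc, div_pow, div_pow,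
    mul_div_assoc', mul_div_assoc'] at this
  have hp : (0 : ℝ) < (n : ℝ) ^ n := by exact_mod_cast Nat.pow_self_pos
  exact (div_le_div_iff_of_pos_right hp).mp this

/-- Every optimal marginal design is concentrated on the contact set of any other one. -/
theorem IsLocallyDOptimalMarginal.ae_mem_contactSet
    (hβ : ∀ i : Fin (n + 1 + 1), 2 ≤ (i : ℕ) → β i = 0)
    (hq : q = fun t => lam (β 0 + β 1 * t)) (hqc : Continuous q) (hq0 : ∀ t, 0 < q t)
    (h : IsLocallyDOptimalMarginal lam β ξ) (h' : IsLocallyDOptimalMarginal lam β ξ') :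
    ∀ᵐ t ∂ξ', t ∈ contactSet n q ξ := by
  have := h'.1
  set f : ℝ → ℝ := fun t => q t * sens n (mom q ξ 0) (mom q ξ 1) (mom q ξ 2) t with hf
  have hfc : Continuous f := hqc.mul (continuous_sens n _ _ _)
  have hsens := h.sens_le hβ hq hqc hq0
  have hdet := ((Matrix.isUnit_iff_isUnit_det _).mp h.2.2.2.1).ne_zero
  have hpos := (infoMatrix_posSemidef hβ hq hqc hq0 h.2.2.1).det_nonneg.lt_of_ne hdet.symm
  have hle := h.isMarginal.det_le hβ hq hqc hq0 (h.mom_det_pos hβ hq hqc hq0).ne'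
    (h.mom_sub_ne_zero hβ hq hqc) h'.2.2.1
  have hge := h'.2.2.2.2 _ h.2.2.1
  have hexp := le_of_mul_le_mul_left ((mul_one _).trans_le (hge.trans hle)) hpos
  rw [Real.one_le_exp_iff, sub_nonneg] at hexp
  rw [integral_invariantDesign_fst h'.isMarginal hfc] at hexp
  have hfi := h'.isMarginal.integrable hfc
  have hnn : 0 ≤ᵐ[ξ'] fun t => (n + 2) - f t := by
    filter_upwards [mem_ae_iff.mpr h'.2.1] with t ht using sub_nonneg.mpr (hsens t ht)
  have hint : ∫ t, ((n : ℝ) + 2) - f t ∂ξ' = 0 := by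
    refine le_antisymm ?_ (integral_nonneg_of_ae hnn)
    rw [integral_sub (integrable_const _) hfi]
    simp; linarith
  have hz := (integral_eq_zero_iff_of_nonneg_ae hnn ((integrable_const _).sub hfi)).mp hint
  filter_upwards [hz, mem_ae_iff.mpr h'.2.1] with t h1 h2
  exact ⟨h2, (sub_eq_zero.mp h1).symm⟩

/-- An optimal marginal design on two given points has both weights positive, so both points are in
its contact set. -/
theorem IsLocallyDOptimalMarginal.isOptimalPair
    (hβ : ∀ i : Fin (n + 1 + 1), 2 ≤ (i : ℕ) → β i = 0)
    (hq : q = fun t => lam (β 0 + β 1 * t)) (hqc : Continuous q) (hq0 : ∀ t, 0 < q t)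
    (h : IsLocallyDOptimalMarginal lam β ξ) (hy : -1 ≤ y) (hyx : y < x) (hx : x ≤ 1)
    (hξ : ξ {x, y}ᶜ = 0) :
    ∃ α, IsOptimalPair n q x y α ∧ ξ = pairMeasure x y α := by
  have := h.1
  have e := eq_pairMeasure hyx.ne hξ
  have hα : ξ.real {x} ∈ Icc (0 : ℝ) 1 := ⟨measureReal_nonneg, measureReal_le_one⟩
  have hD := h.mom_det_pos hβ hq hqc hq0
  have hv := h.mom_sub_ne_zero hβ hq hqc
  have hv' := h.isMarginal.mom_sub_nonneg hqc hq0
  have hs := h.sens_le hβ hq hqc hq0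
  have hae := h.ae_mem_contactSet hβ hq hqc hq0 h
  generalize ξ.real {x} = α at e hα
  subst e
  refine ⟨α, ?_, rfl⟩
  rw [mom_det_pairMeasure hα] at hD
  have hα' : α ∈ Ioo (0 : ℝ) 1 := by
    refine ⟨hα.1.lt_of_ne ?_, hα.2.lt_of_ne ?_⟩
    · rintro rfl; simp at hD
    · rintro rfl; simp at hD
  rw [mom_sub_pairMeasure hα] at hv hv'
  have contact : ∀ t, (pairMeasure x y α).real {t} ≠ 0 → t ∈ contactSet n q (pairMeasure x y α) :=
    fun t ht => by
      by_contra hno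
      refine ht ?_
      rw [measureReal_def, measure_mono_null (singleton_subset_iff.mpr (show t ∈ _ᶜ from hno))
        (mem_ae_iff.mp hae), ENNReal.toReal_zero]
  have eq : ∀ t, t ∈ contactSet n q (pairMeasure x y α) →
      pairSens n q x y α t = (n + 2) * (1 / q t) := fun t ht => by
    have h1 := ht.2
    have h2 := hq0 t
    rw [sens_pairMeasure hq0 hα' hyx] at h1
    rw [← h1]; field_simp
  refine ⟨hα', hy, hyx, hx, fun hn => hv'.lt_of_ne (hv hn).symm, fun t ht => ?_, eq x ?_, eq y ?_⟩
  · have h1 := hs t ht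
    rw [sens_pairMeasure hq0 hα' hyx] at h1
    rw [mul_one_div, le_div_iff₀ (hq0 t)]; linarith
  · refine contact x ?_
    rw [pairMeasure_real_left hα hyx.ne]; exact hα'.1.ne'
  · refine contact y ?_
    rw [pairMeasure_real_right hα hyx.ne]; exact (sub_pos.mpr hα'.2).ne'

theorem IsOptimalPair.isLocallyDOptimalMarginal
    (hβ : ∀ i : Fin (n + 1 + 1), 2 ≤ (i : ℕ) → β i = 0)
    (hq : q = fun t => lam (β 0 + β 1 * t)) (hqc : Continuous q) (hq0 : ∀ t, 0 < q t)
    (h : IsOptimalPair n q x y α) : IsLocallyDOptimalMarginal lam β (pairMeasure x y α) := by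
  have hα := Ioo_subset_Icc_self h.weight
  refine (isMarginal_pairMeasure hα ⟨h.ge.trans h.lt.le, h.le⟩
    ⟨h.ge, h.lt.le.trans h.le⟩).isLocallyDOptimal_of_sens_le hβ hq hqc hq0 ?_ ?_ fun t ht => ?_
  · have h1 := h.weight.1
    have h2 := sub_pos.mpr h.weight.2
    have h3 := sub_pos.mpr h.lt
    have h4 := hq0 x
    have h5 := hq0 y
    rw [mom_det_pairMeasure hα]; positivity
  · intro hn
    rw [mom_sub_pairMeasure hα]; exact (h.reg hn).ne'
  · have h1 := h.bound t ht
    rw [sens_pairMeasure hq0 h.weight h.lt]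
    rw [mul_one_div, le_div_iff₀ (hq0 t)] at h1
    linarith

theorem IsLocallyDOptimalMarginal.exists_isOptimalPair
    (hβ : ∀ i : Fin (n + 1 + 1), 2 ≤ (i : ℕ) → β i = 0)
    (hq : q = fun t => lam (β 0 + β 1 * t)) (hqc : Continuous q)
    (H : IsRecipIntensity (fun t => 1 / q t) U1 U2 c) (h : IsLocallyDOptimalMarginal lam β ξ) :
    ∃ x y α, IsOptimalPair n q x y α ∧ ξ = pairMeasure x y α := by
  obtain ⟨x, y, hy, hyx, hx, hsub⟩ :=
    exists_contactSet_subset_pair H (h.sens_le hβ hq hqc H.q_pos)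
  have h0 : ξ {x, y}ᶜ = 0 := measure_mono_null (compl_subset_compl.mpr hsub)
    (mem_ae_iff.mp (h.ae_mem_contactSet hβ hq hqc H.q_pos h))
  exact ⟨x, y, h.isOptimalPair hβ hq hqc H.q_pos hy hyx hx h0⟩

/-- Two optimal marginal designs live on the same contact set, hence on the same two points, and
there the weight is determined. -/
theorem IsLocallyDOptimalMarginal.unique
    (hβ : ∀ i : Fin (n + 1 + 1), 2 ≤ (i : ℕ) → β i = 0)
    (hq : q = fun t => lam (β 0 + β 1 * t)) (hqc : Continuous q)
    (H : IsRecipIntensity (fun t => 1 / q t) U1 U2 c) (h : IsLocallyDOptimalMarginal lam β ξ)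
    (h' : IsLocallyDOptimalMarginal lam β ξ') : ξ = ξ' := by
  obtain ⟨x, y, hy, hyx, hx, hsub⟩ :=
    exists_contactSet_subset_pair H (h.sens_le hβ hq hqc H.q_pos)
  have key : ∀ ξ', IsLocallyDOptimalMarginal lam β ξ' →
      ∃ α, IsOptimalPair n q x y α ∧ ξ' = pairMeasure x y α := fun ξ' h' =>
    h'.isOptimalPair hβ hq hqc H.q_pos hy hyx hx (measure_mono_null (compl_subset_compl.mpr hsub)
      (mem_ae_iff.mp (h.ae_mem_contactSet hβ hq hqc H.q_pos h')))
  obtain ⟨α, hα, rfl⟩ := key ξ h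
  obtain ⟨α', hα', rfl⟩ := key ξ' h'
  rw [hα.weight_unique hα' H.q_pos]

/-- Probability measures on `[-1, 1]` form a compact space on which the determinant is continuous;
a maximizer is regular because the uniform design on `{0, 1/2}` is. -/
theorem exists_isLocallyDOptimalMarginal
    (hβ : ∀ i : Fin (n + 1 + 1), 2 ≤ (i : ℕ) → β i = 0)
    (hq : q = fun t => lam (β 0 + β 1 * t)) (hqc : Continuous q) (hq0 : ∀ t, 0 < q t) :
    ∃ ξ, IsLocallyDOptimalMarginal lam β ξ := by
  let m : ProbabilityMeasure (Icc (-1 : ℝ) 1) → ℕ → ℝ := fun μ i => ∫ t, q t * (t : ℝ) ^ i ∂(μ :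
    Measure (Icc (-1 : ℝ) 1))
  have hm : ∀ i, Continuous fun μ => m μ i := fun i =>
    ProbabilityMeasure.continuous_integral_boundedContinuousFunction
      (BoundedContinuousFunction.mkOfCompact
        ⟨fun t : Icc (-1 : ℝ) 1 => q t * (t : ℝ) ^ i, by fun_prop⟩)
  have hψ : Continuous fun μ => (m μ 0 * m μ 2 - m μ 1 ^ 2) * (m μ 0 - m μ 2) ^ n := by
    have h0 := hm 0
    have h1 := hm 1
    have h2 := hm 2
    fun_prop
  have hne : Nonempty (ProbabilityMeasure (Icc (-1 : ℝ) 1)) :=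
    ⟨⟨Measure.dirac ⟨0, by simp⟩, inferInstance⟩⟩
  obtain ⟨μ, -, hμ⟩ := isCompact_univ.exists_isMaxOn univ_nonempty hψ.continuousOn
  have emb : MeasurableEmbedding (Subtype.val : Icc (-1 : ℝ) 1 → ℝ) :=
    MeasurableEmbedding.subtype_coe measurableSet_Icc
  set ξ : Measure ℝ := (μ : Measure (Icc (-1 : ℝ) 1)).map Subtype.val with hξdef
  have hξ : IsMarginal ξ := by
    refine ⟨Measure.isProbabilityMeasure_map emb.measurable.aemeasurable, ?_⟩
    rw [hξdef, emb.map_apply]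
    simp
  have hmξ : ∀ i, mom q ξ i = m μ i := fun i => emb.integral_map _
  have hmax : ∀ ξ', IsMarginal ξ' →
      (mom q ξ' 0 * mom q ξ' 2 - mom q ξ' 1 ^ 2) * (mom q ξ' 0 - mom q ξ' 2) ^ n ≤
      (mom q ξ 0 * mom q ξ 2 - mom q ξ 1 ^ 2) * (mom q ξ 0 - mom q ξ 2) ^ n := fun ξ' hξ' => by
    have := hξ'.1
    have hr : ξ'.restrict (Icc (-1) 1) = ξ' :=
      Measure.restrict_eq_self_of_ae_mem (mem_ae_iff.mpr hξ'.2)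
    have hmap : (ξ'.comap Subtype.val : Measure (Icc (-1 : ℝ) 1)).map Subtype.val = ξ' := by
      rw [map_comap_subtype_coe measurableSet_Icc, hr]
    have hp : IsProbabilityMeasure (ξ'.comap Subtype.val : Measure (Icc (-1 : ℝ) 1)) := by
      constructor
      have h1 : ξ' univ = 1 := measure_univ
      rw [← hmap, emb.map_apply] at h1
      simpa using h1
    have hm' : ∀ i, mom q ξ' i = m ⟨ξ'.comap Subtype.val, hp⟩ i := fun i => by
      conv_lhs => rw [← hmap]
      exact emb.integral_map _
    simp only [hm', hmξ]
    exact hμ (mem_univ _)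
  have h12 : (1 / 2 : ℝ) ∈ Icc (0 : ℝ) 1 := by norm_num
  have hpos : 0 < (mom q ξ 0 * mom q ξ 2 - mom q ξ 1 ^ 2) * (mom q ξ 0 - mom q ξ 2) ^ n := by
    refine lt_of_lt_of_le ?_ (hmax (pairMeasure (1 / 2) 0 (1 / 2))
      (isMarginal_pairMeasure h12 (by norm_num) (by norm_num)))
    have h1 := hq0 (1 / 2)
    have h2 := hq0 0
    rw [mom_det_pairMeasure h12, mom_sub_pairMeasure h12, pairB]
    norm_num at h1 ⊢
    positivity
  have hv := hξ.mom_sub_nonneg hqc hq0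
  have hD := pos_of_mul_pos_left hpos (pow_nonneg hv n)
  have hv' : 1 ≤ n → 0 < mom q ξ 0 - mom q ξ 2 := fun hn => by
    refine hv.lt_of_ne fun h0 => ?_
    rw [← h0, zero_pow (by omega), mul_zero] at hpos
    exact hpos.false
  exact ⟨ξ, hξ.isLocallyDOptimal_of_sens_le hβ hq hqc hq0 hD.ne' (fun hn => (hv' hn).ne')
    fun t ht => hξ.sens_le_of_isMax hqc hD hv' hmax ht⟩

end optimal

/-! ### Reciprocals of unimodal intensities -/

section intensity

variable {f lam q : ℝ → ℝ} {c b₀ b₁ : ℝ}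

theorem strictMonoOn_or_strictAntiOn_Ici (hf : Continuous f) (hi : InjOn f (Ici c)) :
    StrictMonoOn f (Ici c) ∨ StrictAntiOn f (Ici c) := by
  have hc1 : c < c + 1 := by linarith
  have h1 : ∀ R, c ≤ R → StrictMonoOn f (Icc c R) ∨ StrictAntiOn f (Icc c R) := fun R hR =>
    hf.continuousOn.strictMonoOn_of_injOn_Icc' hR (hi.mono Icc_subset_Ici_self)
  have hne : f c ≠ f (c + 1) := fun e => hc1.ne (hi self_mem_Ici hc1.le e)
  rcases lt_or_gt_of_ne hne with h | h
  · refine Or.inl fun a ha b hb hab => ?_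
    have hR : c ≤ max b (c + 1) := hc1.le.trans (le_max_right _ _)
    rcases h1 _ hR with hm | hm
    · exact hm ⟨ha, hab.le.trans (le_max_left _ _)⟩ ⟨hb, le_max_left _ _⟩ hab
    · exact absurd (hm ⟨le_rfl, hR⟩ ⟨hc1.le, le_max_right _ _⟩ hc1) h.not_gt
  · refine Or.inr fun a ha b hb hab => ?_
    have hR : c ≤ max b (c + 1) := hc1.le.trans (le_max_right _ _)
    rcases h1 _ hR with hm | hm
    · exact absurd (hm ⟨le_rfl, hR⟩ ⟨hc1.le, le_max_right _ _⟩ hc1) h.not_gt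
    · exact hm ⟨ha, hab.le.trans (le_max_left _ _)⟩ ⟨hb, le_max_left _ _⟩ hab

theorem strictMonoOn_or_strictAntiOn_Iic (hf : Continuous f) (hi : InjOn f (Iic c)) :
    StrictMonoOn f (Iic c) ∨ StrictAntiOn f (Iic c) := by
  have h := strictMonoOn_or_strictAntiOn_Ici (f := fun x => f (-x)) (c := -c) (by fun_prop)
    fun a ha b hb e => neg_injective (hi (show -a ≤ c by linarith [mem_Ici.mp ha])
      (show -b ≤ c by linarith [mem_Ici.mp hb]) e)
  refine h.symm.imp (fun h a ha b hb hab => ?_) (fun h a ha b hb hab => ?_)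
  all_goals
    have := h (mem_Ici.mpr (neg_le_neg (mem_Iic.mp hb))) (mem_Ici.mpr (neg_le_neg (mem_Iic.mp ha)))
      (neg_lt_neg hab)
    simpa using this

theorem contDiff_recip (h : CondA1 lam) : ContDiff ℝ 2 fun x => 1 / lam x := by
  simp only [one_div]
  exact h.2.inv fun x => (h.1 x).ne'

theorem hasDerivAt_recip (h : CondA1 lam) (x : ℝ) :
    HasDerivAt (fun x => 1 / lam x) (deriv (fun x => 1 / lam x) x) x :=
  ((contDiff_recip h).differentiable (by norm_num) x).hasDerivAt

theorem contDiff_deriv_recip (h : CondA1 lam) : ContDiff ℝ 1 (deriv fun x => 1 / lam x) :=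
  (contDiff_succ_iff_deriv (n := 1).mp ((contDiff_recip h).of_le (by norm_num))).2.2

theorem hasDerivAt_deriv_recip (h : CondA1 lam) (x : ℝ) :
    HasDerivAt (deriv fun x => 1 / lam x) (recipDeriv2 lam x) x :=
  ((contDiff_deriv_recip h).differentiable (by norm_num) x).hasDerivAt

theorem continuous_recipDeriv2 (h : CondA1 lam) : Continuous (recipDeriv2 lam) :=
  (contDiff_deriv_recip h).continuous_deriv le_rfl

theorem deriv_recip (h : CondA1 lam) (x : ℝ) :
    deriv (fun x => 1 / lam x) x = -deriv lam x / lam x ^ 2 := by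
  have := ((h.2.differentiable (by norm_num) x).hasDerivAt.inv (h.1 x).ne').deriv
  rw [← this]; congr 1; ext; simp

theorem deriv_recip_neg (h : CondA1 lam) (h2 : CondA2' lam c) {x : ℝ} (hx : x < c) :
    deriv (fun x => 1 / lam x) x < 0 := by
  rw [deriv_recip h]
  exact div_neg_of_neg_of_pos (neg_neg_of_pos (h2.1 x hx)) (pow_pos (h.1 x) 2)

theorem deriv_recip_pos (h : CondA1 lam) (h2 : CondA2' lam c) {x : ℝ} (hx : c < x) :
    0 < deriv (fun x => 1 / lam x) x := by
  rw [deriv_recip h]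
  exact div_pos (neg_pos.mpr (h2.2 x hx)) (pow_pos (h.1 x) 2)

theorem deriv_recip_mode (h : CondA1 lam) (h2 : CondA2' lam c) :
    deriv (fun x => 1 / lam x) c = 0 := by
  have hc := (contDiff_deriv_recip h).continuous
  refine le_antisymm ?_ ?_
  · have : closure (Iio c) ⊆ {x | deriv (fun x => 1 / lam x) x ≤ 0} :=
      closure_minimal (fun x hx => (deriv_recip_neg h h2 hx).le) (isClosed_le hc continuous_const)
    exact this (by simp)
  · have : closure (Ioi c) ⊆ {x | 0 ≤ deriv (fun x => 1 / lam x) x} :=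
      closure_minimal (fun x hx => (deriv_recip_pos h h2 hx).le) (isClosed_le continuous_const hc)
    exact this (by simp)

/-- A strictly decreasing `u''` would bound `u` by a quadratic on `[c, ∞)`, against `u / x² → ∞`. -/
theorem strictMonoOn_recipDeriv2_Ici (h1 : CondA1 lam) (h2 : CondA2' lam c) (h3 : CondA3' lam c)
    (h5 : CondA5 lam) : StrictMonoOn (recipDeriv2 lam) (Ici c) := by
  refine (strictMonoOn_or_strictAntiOn_Ici (continuous_recipDeriv2 h1) h3.2).resolve_right
    fun hanti => ?_
  set K := |recipDeriv2 lam c|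
  obtain ⟨x, hxM, hx⟩ := ((h5.eventually_gt_atTop (1 / lam c + 2 * K)).and
    (eventually_gt_atTop (|c| + 1))).exists
  have hxc : c < x := by linarith [le_abs_self c]
  have hx1 : 1 ≤ x := by linarith [abs_nonneg c]
  have hcx : |c| ≤ x := by linarith
  obtain ⟨s, hs, e⟩ := exists_taylor_two (hasDerivAt_recip h1) (hasDerivAt_deriv_recip h1) hxc.ne
  rw [min_eq_left hxc.le, max_eq_right hxc.le] at hs
  have hsK : recipDeriv2 lam s ≤ K :=
    (hanti self_mem_Ici hs.1.le hs.1).le.trans (le_abs_self _)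
  rw [deriv_recip_mode h1 h2] at e
  have hu : 0 < 1 / lam x := one_div_pos.mpr (h1.1 x)
  have huc : 0 < 1 / lam c := one_div_pos.mpr (h1.1 c)
  have hx2 : 0 < x ^ 2 := by positivity
  rw [abs_of_pos (by positivity), lt_div_iff₀ hx2] at hxM
  have hsq : (x - c) ^ 2 ≤ 4 * x ^ 2 := by
    have := (abs_sub x c).trans (add_le_add (abs_of_pos (by linarith : 0 < x)).le hcx)
    have := sq_le_sq' (by linarith [neg_abs_le (x - c)]) ((le_abs_self _).trans this)
    linarith
  have hK : 0 ≤ K := abs_nonneg _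
  have i1 : recipDeriv2 lam s * (x - c) ^ 2 ≤ K * (4 * x ^ 2) :=
    (mul_le_mul_of_nonneg_right hsK (sq_nonneg _)).trans (mul_le_mul_of_nonneg_left hsq hK)
  have i2 : 1 / lam c * 1 ≤ 1 / lam c * x ^ 2 :=
    mul_le_mul_of_nonneg_left (one_le_pow₀ hx1) huc.le
  linarith

theorem isRecipIntensity_comp (h1 : CondA1 lam) (h2 : CondA2' lam c) (h3 : CondA3' lam c)
    (h5 : CondA5 lam) (hb : 0 < b₁) :
    IsRecipIntensity (fun t => 1 / lam (b₀ + b₁ * t))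
      (fun t => b₁ * deriv (fun x => 1 / lam x) (b₀ + b₁ * t))
      (fun t => b₁ ^ 2 * recipDeriv2 lam (b₀ + b₁ * t)) ((c - b₀) / b₁) := by
  have aff : ∀ t : ℝ, HasDerivAt (fun t => b₀ + b₁ * t) b₁ t := fun t => by
    simpa using ((hasDerivAt_id t).const_mul b₁).const_add b₀
  have hlt : ∀ t, t < (c - b₀) / b₁ ↔ b₀ + b₁ * t < c := fun t => by
    rw [lt_div_iff₀ hb]; constructor <;> intro <;> linarith
  have hgt : ∀ t, (c - b₀) / b₁ < t ↔ c < b₀ + b₁ * t := fun t => by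
    rw [div_lt_iff₀ hb]; constructor <;> intro <;> linarith
  have hmono : ∀ {a b : ℝ}, a < b → b₀ + b₁ * a < b₀ + b₁ * b := fun h => by nlinarith
  have hb2 : 0 < b₁ ^ 2 := by positivity
  refine ⟨fun t => one_div_pos.mpr (h1.1 _), fun t => ?_, fun t => ?_, fun t ht => ?_,
    fun t ht => ?_, ?_, ?_, ?_⟩
  · exact ((hasDerivAt_recip h1 _).comp t (aff t)).congr_deriv (mul_comm _ _)
  · exact (((hasDerivAt_deriv_recip h1 _).comp t (aff t)).const_mul b₁).congr_deriv (by ring)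
  · exact mul_neg_of_pos_of_neg hb (deriv_recip_neg h1 h2 ((hlt t).mp ht))
  · exact mul_pos hb (deriv_recip_pos h1 h2 ((hgt t).mp ht))
  · have : b₀ + b₁ * ((c - b₀) / b₁) = c := by field_simp; ring
    rw [this, deriv_recip_mode h1 h2, mul_zero]
  · intro a ha b hb' hab
    refine mul_lt_mul_of_pos_left (strictMonoOn_recipDeriv2_Ici h1 h2 h3 h5 ?_ ?_ (hmono hab)) hb2
    · exact not_lt.mp fun h => (not_lt.mpr ha) ((hlt a).mpr h)
    · exact not_lt.mp fun h => (not_lt.mpr hb') ((hlt b).mpr h)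
  · refine (strictMonoOn_or_strictAntiOn_Iic (continuous_recipDeriv2 h1) h3.1).imp
      (fun h a ha b hb' hab => ?_) (fun h a ha b hb' hab => ?_)
    all_goals
      refine mul_lt_mul_of_pos_left (h ?_ ?_ (hmono hab)) hb2
      · exact not_lt.mp fun h => (not_lt.mpr ha) ((hgt a).mpr h)
      · exact not_lt.mp fun h => (not_lt.mpr hb') ((hgt b).mpr h)

theorem strictAntiOn_recipDeriv2_comp (h : StrictAntiOn (recipDeriv2 lam) (Iic c)) (hb : 0 < b₁) :
    StrictAntiOn (fun t => b₁ ^ 2 * recipDeriv2 lam (b₀ + b₁ * t)) (Iic ((c - b₀) / b₁)) := by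
  intro a ha b hb' hab
  rw [mem_Iic, le_div_iff₀ hb] at ha hb'
  exact mul_lt_mul_of_pos_left (h (show b₀ + b₁ * a ≤ c by linarith)
    (show b₀ + b₁ * b ≤ c by linarith) (by nlinarith)) (by positivity)

theorem antitone_logDeriv_comp (h1 : CondA1 lam) (h4 : CondA4 lam) (hb : 0 < b₁)
    (hq : q = fun t => lam (b₀ + b₁ * t)) : Antitone fun t => deriv q t / q t := by
  have aff : ∀ t : ℝ, HasDerivAt (fun t => b₀ + b₁ * t) b₁ t := fun t => by
    simpa using ((hasDerivAt_id t).const_mul b₁).const_add b₀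
  have e : ∀ t, deriv q t / q t = b₁ * (deriv lam (b₀ + b₁ * t) / lam (b₀ + b₁ * t)) := fun t => by
    have := ((h1.2.differentiable (by norm_num) (b₀ + b₁ * t)).hasDerivAt.comp t (aff t)).deriv
    rw [hq]
    change deriv (lam ∘ fun t => b₀ + b₁ * t) t / _ = _
    rw [this]; ring
  intro a b hab
  simp only [e]
  exact mul_le_mul_of_nonneg_left (h4 (by nlinarith)) hb.le

end intensity

/-! ### The optimal marginal design -/

theorem mainTheorem1 (k : ℕ) (hk : 1 ≤ k) (lam : ℝ → ℝ) (c : ℝ) (β : Fin (k + 1) → ℝ)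
    (hA1 : CondA1 lam) (hA2 : CondA2' lam c) (hA3 : CondA3' lam c) (hA5 : CondA5 lam)
    (hβ₁ : 0 < β 1) (hβ : ∀ i : Fin (k + 1), 2 ≤ (i : ℕ) → β i = 0)
    (q : ℝ → ℝ) (hq : q = fun t => lam (β 0 + β 1 * t)) :
    (∃! ξ₁ : Measure ℝ, IsLocallyDOptimalMarginal lam β ξ₁) ∧
    ∀ ξ₁ : Measure ℝ, IsLocallyDOptimalMarginal lam β ξ₁ →
      ∃ x₁₁ x₁₂ : ℝ, x₁₁ ∈ Icc (-1) 1 ∧ x₁₂ ∈ Icc (-1) 1 ∧ x₁₂ < x₁₁ ∧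
        ξ₁.support = {x₁₁, x₁₂} ∧
        (1 < (c - β 0) / β 1 →
          ((k = 1 ∨ StrictAntiOn (recipDeriv2 lam) (Iic c)) → UpperForm k q ξ₁ x₁₁ x₁₂) ∧
          (CondA4 lam → UpperUnique k q)) ∧
        ((c - β 0) / β 1 < -1 →
          LowerForm k q ξ₁ x₁₁ x₁₂ ∧ (CondA4 lam → LowerUnique k q)) ∧
        ((c - β 0) / β 1 ∈ Icc (-1) 1 →
          (∀ x y α : ℝ, InteriorSolution k q x y α →
            x₁₁ = x ∧ x₁₂ = y ∧ ξ₁.real {x₁₁} = α ∧ ξ₁.real {x₁₂} = 1 - α) ∧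
          ((¬ ∃ x y α : ℝ, InteriorSolution k q x y α) →
            (UpperForm k q ξ₁ x₁₁ x₁₂ ∨ LowerForm k q ξ₁ x₁₁ x₁₂))) := by
  obtain ⟨n, rfl⟩ : ∃ n, k = n + 1 := ⟨k - 1, by omega⟩
  have H := isRecipIntensity_comp (b₀ := β 0) hA1 hA2 hA3 hA5 hβ₁
  have hqc : Continuous q := by
    have := hA1.2.continuous
    rw [hq]; fun_prop
  have hU : (fun t => 1 / lam (β 0 + β 1 * t)) = fun t => 1 / q t := by rw [hq]
  rw [hU] at H
  obtain ⟨ξ, hξ⟩ := exists_isLocallyDOptimalMarginal hβ hq hqc H.q_pos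
  refine ⟨⟨ξ, hξ, fun ξ' hξ' => hξ'.unique hβ hq hqc H hξ⟩, fun ξ₁ hξ₁ => ?_⟩
  obtain ⟨x, y, α, h, rfl⟩ := hξ₁.exists_isOptimalPair hβ hq hqc H
  have hα := Ioo_subset_Icc_self h.weight
  have ex := pairMeasure_real_left hα h.lt.ne
  have ey := pairMeasure_real_right hα h.lt.ne
  refine ⟨x, y, ⟨h.ge.trans h.lt.le, h.le⟩, ⟨h.ge, h.lt.le.trans h.le⟩, h.lt,
    support_pairMeasure h.weight, fun hc => ⟨fun hanti => ?_, fun hA4 => ?_⟩,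
    fun hc => ⟨?_, fun hA4 => ?_⟩, fun _ => ⟨fun x' y' α' hsol => ?_, fun hno => ?_⟩⟩
  · refine h.upperForm H (h.x_eq_one H hc (hanti.imp (fun hk => by omega) fun ha => ?_)) ex ey
    exact strictAntiOn_recipDeriv2_comp ha hβ₁
  · exact upperUnique_of_antitone _ (antitone_logDeriv_comp hA1 hA4 hβ₁ hq)
  · exact h.lowerForm H (h.y_eq_neg_one H hc) ex ey
  · exact lowerUnique_of_antitone _ (antitone_logDeriv_comp hA1 hA4 hβ₁ hq)
  · have h' := H.isOptimalPair hsol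
    have e := (h'.isLocallyDOptimalMarginal hβ hq hqc H.q_pos).unique hβ hq hqc H hξ₁
    have hα' := Ioo_subset_Icc_self h'.weight
    -- The ordered pair of points is recovered from the support of the measure.
    have hs := congrArg Measure.support e
    rw [support_pairMeasure h.weight, support_pairMeasure h'.weight] at hs
    have hxy : x = x' ∧ y = y' := by
      rcases Set.pair_eq_pair_iff.mp hs with ⟨h1, h2⟩ | ⟨h1, h2⟩
      · exact ⟨h1.symm, h2.symm⟩
      · have := h.lt
        have := h'.lt
        linarith
    obtain ⟨rfl, rfl⟩ := hxy
    rw [← e]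
    exact ⟨rfl, rfl, pairMeasure_real_left hα' h.lt.ne, pairMeasure_real_right hα' h.lt.ne⟩
  · by_cases hx : x = 1
    · exact Or.inl (h.upperForm H hx ex ey)
    · by_cases hy : y = -1
      · exact Or.inr (h.lowerForm H hy ex ey)
      · exact absurd ⟨x, y, α, h.interiorSolution H (lt_of_le_of_ne h.ge (Ne.symm hy))
          (lt_of_le_of_ne h.le hx)⟩ hno
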